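/- Let $n$ be a natural number. There is a constant $C(n)>0$, depending only on $n$, such that the following holds. Setting. Let $U,V\subset\mathbb R^n$ be open and bounded and let $c\in C^4(\overline U\times\overline V)$ (B0). Assume: (B1) for all $(\tilde x,\tilde y)\in\overline U\times\overline V$ the maps $x\in\overline U\mapsto -D_yc(x,\tilde y)$ and $y\in\overline V\mapsto -D_xc(\tilde x,y)$ are diffeomorphisms onto their ranges; (B2) for all $(\tilde x,\tilde y)\in\overline U\times\overline V$ the sets $U_{\tilde y}:=-D_yc(U,\tilde y)$ and $V_{\tilde x}:=-D_xc(\tilde x,V)$ are convex; (B3) for all curves $x:[-1,1]\to\overline U$, $y:[-1,1]\to\overline V$ such that $t\mapsto (D_yc(x(t),y(0)),D_xc(x(0),y(t)))$ is an affinely parameterized line segment, $\frac{\partial^2}{\partial s\partial t}\big|_{(0,0)}c(x(s),y(t))=0$ implies $-\frac{\partial^4}{\partial s^2\partial t^2}\big|_{(0,0)}c(x(s),y(t))\ge 0$. Put $\beta_c^{\pm}=\|(D^2_{xy}c)^{\pm1}\|_{L^\infty(U\times V)}$ and define $\varepsilon_c\in(0,\infty]$ by $\varepsilon_c^{-1}=2(\beta_c^+)^4(\beta_c^-)^6\|D^3_{xxy}c\|_{L^\infty(U\times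 V)}$ (operator norms). Fix $\bar y\in\overline V$, let $q\in\overline{U_{\bar y}}\mapsto x(q)\in\overline U$ be the inverse of $x\mapsto -D_yc(x,\bar y)$, and let $\tilde c(q,y)=c(x(q),y)-c(x(q),\bar y)$ on $\overline{U_{\bar y}}\times\overline V$. Let $\tilde u:\overline{U_{\bar y}}\to\mathbb R$ be $\tilde c$-convex, i.e. $\tilde u(q)=\sup_{y\in\overline V}(-\tilde c(q,y)-\tilde u^{\tilde c^*}(y))$, where $\tilde u^{\tilde c^*}(y)=\sup_{q\in\overline{U_{\bar y}}}(-\tilde c(q,y)-\tilde u(q))$. Write $\partial^{\tilde c}\tilde u(q)=\{y\in\overline V:\tilde u(q)+\tilde u^{\tilde c^*}(y)+\tilde c(q,y)=0\}$ and $|\partial^{\tilde c}\tilde u|(A)=\mathcal L^n\big(\bigcup_{q\in A}\partial^{\tilde c}\tilde u(q)\big)$. Let $Q=\{q\in\overline{U_{\bar y}}:\tilde u(q)\le 0\}$ and $\gamma^-_{\tilde c}=\|\det (D^2_{qy}\tilde c)^{-1}\|_{L^\infty(Q\times V)}$. Conclusion. The set $Q$ is convex. Moreover, let $E$ be a closed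 ellipsoid (with nonempty interior) with $E\subset Q\subset n\cdot E$, where $r\cdot E$ denotes the dilation of $E$ by the factor $r$ about its centre. Let $x_0\in\mathbb R^n$ and $\delta>0$ be such that $\delta\le\min\{1,\varepsilon_c/(4\operatorname{diam}E)\}$ and the ellipsoid $E_\delta:=x_0+\delta\cdot E$ is contained in $Q$. Suppose that $\lambda>0$ and $|\partial^{\tilde c}\tilde u|(A)\ge\lambda\,\mathcal L^n(A)$ for every Borel set $A\subset E_\delta$, and that there are $z\in\mathbb R^n$ and $r>0$ such that $E_\delta$ lies in the closed ball of radius $r$ about $z$ and the open ball of radius $4r$ about $z$ lies in $U_{\bar y}$. Then $$\mathcal L^n(Q)^2\le C(n)\,\frac{\gamma^-_{\tilde c}}{\delta^{2n}\lambda}\,\Big|\inf_Q\tilde u\Big|^n .$$ -/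

import Mathlib

noncomputable section

namespace OptTransport

open MeasureTheory Set

/-- Euclidean space `ℝⁿ`. -/
abbrev Eu (n : ℕ) : Type := EuclideanSpace ℝ (Fin n)

section Cost

variable {n : ℕ}

/-! ### Derivatives of a cost `b` on `closure X × closure Y`, up to the boundary -/

/-- `D_x b(x, y)`, a vector of `ℝⁿ`. -/
def gradFst (b : Eu n → Eu n → ℝ) (X : Set (Eu n)) (x y : Eu n) : Eu n :=
  gradientWithin (fun x' => b x' y) (closure X) x

/-- `D_y b(x, y)`, a vector of `ℝⁿ`. -/
def gradSnd (b : Eu n → Eu n → ℝ) (Y : Set (Eu n)) (x y : Eu n) : Eu n :=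
  gradientWithin (fun y' => b x y') (closure Y) y

/-- `D²_{xy} b(x, y)`, the derivative of `y ↦ D_x b(x, y)`, as a linear map of `ℝⁿ`. -/
def mixedHessian (b : Eu n → Eu n → ℝ) (X Y : Set (Eu n)) (x y : Eu n) : Eu n →L[ℝ] Eu n :=
  fderivWithin ℝ (fun y' => gradFst b X x y') (closure Y) y

/-- `D³_{xxy} b(x, y)`, the derivative of `x ↦ D²_{xy} b(x, y)`. -/
def mixedThird (b : Eu n → Eu n → ℝ) (X Y : Set (Eu n)) (x y : Eu n) :
    Eu n →L[ℝ] Eu n →L[ℝ] Eu n :=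
  fderivWithin ℝ (fun x' => mixedHessian b X Y x' y) (closure X) x

/-! ### The hypotheses on the cost -/

/-- `f` is a `C¹` diffeomorphism of the set `S` onto its image `f(S)`. -/
def IsDiffeoOntoImage (f : Eu n → Eu n) (S : Set (Eu n)) : Prop :=
  ContDiffOn ℝ 1 f S ∧ ∃ g : Eu n → Eu n, ContDiffOn ℝ 1 g (f '' S) ∧ LeftInvOn g f S

/-- `U_y = -D_y b(U, y)`. -/
def domFrom (b : Eu n → Eu n → ℝ) (U V : Set (Eu n)) (y : Eu n) : Set (Eu n) :=
  (fun x => -gradSnd b V x y) '' U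

/-- `V_x = -D_x b(x, V)`. -/
def codomFrom (b : Eu n → Eu n → ℝ) (U V : Set (Eu n)) (x : Eu n) : Set (Eu n) :=
  (fun y => -gradFst b U x y) '' V

/-- (B0): `U`, `V` are open and bounded, and `c` is `C⁴` on `closure U × closure V`. -/
def CondB0 (c : Eu n → Eu n → ℝ) (U V : Set (Eu n)) : Prop :=
  IsOpen U ∧ Bornology.IsBounded U ∧ IsOpen V ∧ Bornology.IsBounded V ∧
    ContDiffOn ℝ 4 (fun z : Eu n × Eu n => c z.1 z.2) (closure U ×ˢ closure V)

/-- (B1), bi-twist. -/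
def CondB1 (c : Eu n → Eu n → ℝ) (U V : Set (Eu n)) : Prop :=
  (∀ y ∈ closure V, IsDiffeoOntoImage (fun x => -gradSnd c V x y) (closure U)) ∧
  (∀ x ∈ closure U, IsDiffeoOntoImage (fun y => -gradFst c U x y) (closure V))

/-- (B2), bi-convexity. -/
def CondB2 (c : Eu n → Eu n → ℝ) (U V : Set (Eu n)) : Prop :=
  (∀ y ∈ closure V, Convex ℝ (domFrom c U V y)) ∧
  (∀ x ∈ closure U, Convex ℝ (codomFrom c U V x))

/-- (B3), also known as (A3w): for curves `x(t)`, `y(t)`, `t ∈ [-1, 1]`, such that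
`D_y c(x(t), y(0))` and `D_x c(x(0), y(t))` are affinely parameterized line segments, the
cross-curvature `-∂⁴/∂s²∂t² c(x(s), y(t))` at `s = t = 0` is nonnegative as soon as
`∂²/∂s∂t c(x(s), y(t))` vanishes at `s = t = 0`. -/
def CondB3 (c : Eu n → Eu n → ℝ) (U V : Set (Eu n)) : Prop :=
  ∀ x y : ℝ → Eu n,
    (∀ t ∈ Icc (-1 : ℝ) 1, x t ∈ closure U) →
    (∀ t ∈ Icc (-1 : ℝ) 1, y t ∈ closure V) →
    (∃ a v : Eu n, ∀ t ∈ Icc (-1 : ℝ) 1, gradSnd c V (x t) (y 0) = a + t • v) →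
    (∃ a v : Eu n, ∀ t ∈ Icc (-1 : ℝ) 1, gradFst c U (x 0) (y t) = a + t • v) →
    deriv (fun s : ℝ => deriv (fun t : ℝ => c (x s) (y t)) 0) 0 = 0 →
    0 ≤ -iteratedDeriv 2 (fun s : ℝ => iteratedDeriv 2 (fun t : ℝ => c (x s) (y t)) 0) 0

/-! ### The constants `β^±`, `γ^-`, `ε_c` -/

/-- `β⁺_b = ‖D²_{xy} b‖` in `L^∞(U × V)`. -/
def betaPlus (b : Eu n → Eu n → ℝ) (U V : Set (Eu n)) : ENNReal :=
  eLpNorm (fun z : Eu n × Eu n => mixedHessian b U V z.1 z.2) ⊤ (volume.restrict (U ×ˢ V))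

/-- `β⁻_b = ‖(D²_{xy} b)⁻¹‖` in `L^∞(U × V)`. -/
def betaMinus (b : Eu n → Eu n → ℝ) (U V : Set (Eu n)) : ENNReal :=
  eLpNorm (fun z : Eu n × Eu n => (mixedHessian b U V z.1 z.2).inverse) ⊤
    (volume.restrict (U ×ˢ V))

/-- `γ⁻_b(Q × V) = ‖det (D²_{xy} b)⁻¹‖` in `L^∞(Q × V)`, for a cost `b` on
`closure U × closure V` and `Q ⊆ closure U`. -/
def gammaMinus (b : Eu n → Eu n → ℝ) (U V Q : Set (Eu n)) : ENNReal :=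
  eLpNorm (fun z : Eu n × Eu n => ((mixedHessian b U V z.1 z.2).det)⁻¹) ⊤
    (volume.restrict (Q ×ˢ V))

/-- `ε_c`, given by `ε_c⁻¹ = 2 (β⁺_c)⁴ (β⁻_c)⁶ ‖D³_{xxy} c‖` with the last norm in
`L^∞(U × V)`; it is `∞` when `D³_{xxy} c` vanishes. -/
def epsCost (c : Eu n → Eu n → ℝ) (U V : Set (Eu n)) : ENNReal :=
  (2 * betaPlus c U V ^ 4 * betaMinus c U V ^ 6 *
    eLpNorm (fun z : Eu n × Eu n => mixedThird c U V z.1 z.2) ⊤ (volume.restrict (U ×ˢ V)))⁻¹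

/-! ### Cost exponential coordinates and the modified cost -/

/-- `x(q)`: the inverse of `x ∈ closure U ↦ q(x) = -D_y c(x, ȳ)`. -/
def costExp (c : Eu n → Eu n → ℝ) (U V : Set (Eu n)) (ybar q : Eu n) : Eu n :=
  Function.invFunOn (fun x => -gradSnd c V x ybar) (closure U) q

/-- The modified cost at `ȳ`: `c̃(q, y) = c(x(q), y) - c(x(q), ȳ)`. -/
def modCost (c : Eu n → Eu n → ℝ) (U V : Set (Eu n)) (ybar q y : Eu n) : ℝ :=
  c (costExp c U V ybar q) y - c (costExp c U V ybar q) ybar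

/-! ### `b`-convex functions on a compact set `X` (with target `Y`) -/

/-- `v = u^{b*}` on `Y`, i.e. `v(y) = sup_{x ∈ X} (-b(x, y) - u(x))` for `y ∈ Y`. -/
def IsTransform (b : Eu n → Eu n → ℝ) (X Y : Set (Eu n)) (u v : Eu n → ℝ) : Prop :=
  ∀ y ∈ Y, IsLUB ((fun x => -b x y - u x) '' X) (v y)

/-- `u` is `b`-convex on `X`: `u = (u^{b*})^b`. -/
def IsCostConvex (b : Eu n → Eu n → ℝ) (X Y : Set (Eu n)) (u : Eu n → ℝ) : Prop :=
  ∃ v : Eu n → ℝ, IsTransform b X Y u v ∧ IsTransform (fun y x => b x y) Y X v u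

/-- `∂^b u(x)`: the `y ∈ Y` with `u(x) + u^{b*}(y) + b(x, y) = 0`, that is,
`sup_{x' ∈ X} (-b(x', y) - u(x')) = -b(x, y) - u(x)`; it is empty for `x ∉ X`. -/
def costSubdiff (b : Eu n → Eu n → ℝ) (X Y : Set (Eu n)) (u : Eu n → ℝ) (x : Eu n) :
    Set (Eu n) :=
  {y | x ∈ X ∧ y ∈ Y ∧ IsLUB ((fun x' => -b x' y - u x') '' X) (-b x y - u x)}

/-- The `b`-Monge-Ampère measure: `|∂^b u|(A) = ℒⁿ(⋃_{x ∈ A} ∂^b u(x))`. -/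
def mongeAmpere (b : Eu n → Eu n → ℝ) (X Y : Set (Eu n)) (u : Eu n → ℝ) (A : Set (Eu n)) :
    ENNReal :=
  volume (⋃ x ∈ A, costSubdiff b X Y u x)

/-- `|∂^b u| ≥ lam` on `S`. -/
def MongeAmpereGE (b : Eu n → Eu n → ℝ) (X Y : Set (Eu n)) (u : Eu n → ℝ) (lam : ℝ)
    (S : Set (Eu n)) : Prop :=
  ∀ A : Set (Eu n), MeasurableSet A → A ⊆ S →
    ENNReal.ofReal lam * volume A ≤ mongeAmpere b X Y u A

/-- The dilation by the factor `r`, about its centre `a`, of the closed ellipsoid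
`a + L(closed unit ball)`. -/
def ellipsoid (a : Eu n) (L : Eu n ≃L[ℝ] Eu n) (r : ℝ) : Set (Eu n) :=
  (fun v => a + r • L v) '' Metric.closedBall 0 1

end Cost

end OptTransport

end

/-!
# Convex sections and an Alexandrov estimate under the weak Ma-Trudinger-Wang condition

**Convexity of sections.** A `c̃`-convex function is a supremum of functions `-c̃(·, y) + const`, so
it suffices that every `-c̃(·, y)` is quasiconvex on the convex body `closure U_ȳ`
(`RegularCost.quasiconvexOn_neg_modCost`). Let `x(t)` be the curve in `closure U` corresponding to a
line segment in the coordinates `q = -D_y c(x, ȳ)`, and `f(t) = -c(x(t), y) + c(x(t), ȳ)`. At a fixed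
time, join `ȳ` to `y` by the curve `y(s)` along which `-D_x c(x, y(s))` moves affinely from `p̄` to
`p̄ + η`. Then `f' = ⟪η, ẋ⟫`, and `f''` is the increment over `s ∈ [0, 1]` of a function which has
slope zero at `s = 0`, as `D_y c(x(t), ȳ)` is affine in `t`, and whose second derivative in `s` is the
cross-curvature in the directions `ẋ`, `η`. Condition (B3) says that the cross-curvature is
nonnegative if `⟪η, ẋ⟫ = 0` (`RegularCost.segHessian_nonpos`); splitting off the component of `ẋ`
along `η` this gives `f'' ≥ -C |f'|` (`RegularCost.second_variation_ge`), and hence the maximum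
principle (`le_max_of_neg_mul_abs_deriv_le`). All derivatives are taken on `closure U × closure V`:
by (B1) and (B2) both factors are diffeomorphic to convex bodies, so derivatives are unique up to the
boundary (`IsDiffeoOntoImage.regular`), and second derivatives are symmetric there.

**The volume estimate.** Let `q₀` be the centre of `E_δ`, and let `y` be a subgradient at a point of
the concentric ellipsoid of half the size. The supporting function `f = -c̃(·, y) + const` is
quasiconvex, nonpositive on `E_δ`, and at least `-h` at that point, where `h = |inf_Q ũ|`. Integrating
`D²_{xy} c` along curves as above shows that `∇f` varies slowly relative to its own size
(`RegularCost.norm_modGrad_sub_le`); by the choice of `ε_c`, it is almost constant in a Euclidean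
ball around `E_δ`. Together with quasiconvexity this bounds `∇f(q₀)`, in the norm dual to `E_δ`, by
`15 h` (`inner_le_of_quasiconvexOn`). So all these `y` are mapped by `y ↦ D_q c̃(q₀, y)` into a body
of volume at most a constant times `h ^ n / (δ ^ n vol(E))`. The change of variables costs a factor
`γ⁻`, and comparison with the lower bound `lam` on the Monge-Ampère measure gives the estimate.
-/


open MeasureTheory Set
open scoped Topology RealInnerProductSpace ContDiff

-- needed for instances on iterated spaces of continuous linear maps
set_option maxSynthPendingDepth 3

noncomputable section

namespace OptTransport

/-! ### Diffeomorphisms of closed domains onto convex bodies -/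

section Diffeo

variable {n : ℕ} {f : Eu n → Eu n} {S : Set (Eu n)}

theorem comp_fderiv_eq_id_of_leftInvOn (hS : IsOpen S) {x : Eu n} (hx : x ∈ S) {g : Eu n → Eu n}
    {g' : Eu n →L[ℝ] Eu n} (hg : HasFDerivWithinAt g g' (f '' closure S) (f x))
    (hgf : LeftInvOn g f (closure S)) {f' : Eu n →L[ℝ] Eu n} (hf' : HasFDerivAt f f' x) :
    g'.comp f' = ContinuousLinearMap.id ℝ (Eu n) := by
  have hcomp : HasFDerivWithinAt (g ∘ f) (g'.comp f') (closure S) x :=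
    hg.comp x hf'.hasFDerivWithinAt (mapsTo_image f _)
  have hid : HasFDerivWithinAt id (g'.comp f') (closure S) x :=
    hcomp.congr (fun y hy => (hgf hy).symm) (hgf (subset_closure hx)).symm
  exact (hid.hasFDerivAt (mem_nhds_iff.2 ⟨S, subset_closure, hS, hx⟩)).unique (hasFDerivAt_id x)

theorem surjective_of_comp_eq_id {g' f' : Eu n →L[ℝ] Eu n}
    (h : g'.comp f' = ContinuousLinearMap.id ℝ (Eu n)) :
    Function.Surjective f' ∧ Function.Surjective g' := by
  have h1 : ∀ v, g' (f' v) = v := fun v => by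
    simpa using congrArg (fun T : Eu n →L[ℝ] Eu n => T v) h
  have hinj : Function.Injective (f' : Eu n →ₗ[ℝ] Eu n) := fun a b hab => by
    have := congrArg g' (show f' a = f' b from hab)
    rwa [h1, h1] at this
  exact ⟨(LinearMap.injective_iff_surjective.1 hinj), fun v => ⟨f' v, h1 v⟩⟩

theorem IsDiffeoOntoImage.isOpen_image (hS : IsOpen S) (hf : IsDiffeoOntoImage f (closure S)) :
    IsOpen (f '' S) := by
  obtain ⟨hfc, g, hgc, hgf⟩ := hf
  rw [isOpen_iff_mem_nhds]
  rintro _ ⟨x, hx, rfl⟩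
  have hnhds : closure S ∈ 𝓝 x := mem_nhds_iff.2 ⟨S, subset_closure, hS, hx⟩
  have hstr := (hfc.contDiffAt hnhds).hasStrictFDerivAt one_ne_zero
  have hg := ((hgc.differentiableOn one_ne_zero) (f x)
    (mem_image_of_mem f (subset_closure hx))).hasFDerivWithinAt
  have hid := comp_fderiv_eq_id_of_leftInvOn hS hx hg hgf
    hstr.hasFDerivAt
  have := hstr.map_nhds_eq_of_surj (LinearMap.range_eq_top.2 (surjective_of_comp_eq_id hid).1)
  rw [← this]
  exact Filter.image_mem_map (hS.mem_nhds hx)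

theorem IsDiffeoOntoImage.image_closure (hb : Bornology.IsBounded S)
    (hf : IsDiffeoOntoImage f (closure S)) : f '' closure S = closure (f '' S) := by
  refine Subset.antisymm hf.1.continuousOn.image_closure ?_
  exact closure_minimal (image_mono subset_closure)
    (hb.isCompact_closure.image_of_continuousOn hf.1.continuousOn).isClosed

theorem IsDiffeoOntoImage.uniqueDiffOn_image (hS : IsOpen S) (hne : S.Nonempty)
    (hb : Bornology.IsBounded S) (hf : IsDiffeoOntoImage f (closure S))
    (hc : Convex ℝ (f '' S)) : UniqueDiffOn ℝ (f '' closure S) := by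
  rw [hf.image_closure hb]
  refine uniqueDiffOn_convex hc.closure ?_
  exact (hne.image f).mono (interior_maximal subset_closure (hf.isOpen_image hS))

/-- If the image of `S` is convex, a diffeomorphism of `closure S` has an invertible derivative up
to the boundary, and `closure S` inherits unique differentiability from the convex body onto which
it is mapped: the derivative of the inverse is onto at boundary points by continuity. -/
theorem IsDiffeoOntoImage.regular (hS : IsOpen S) (hb : Bornology.IsBounded S)
    (hf : IsDiffeoOntoImage f (closure S)) (hc : Convex ℝ (f '' S)) {x : Eu n}
    (hx : x ∈ closure S) :
    UniqueDiffWithinAt ℝ (closure S) x ∧ (fderivWithin ℝ f (closure S) x).IsInvertible := by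
  have hne : S.Nonempty := closure_nonempty_iff.1 ⟨x, hx⟩
  have hT := hf.uniqueDiffOn_image hS hne hb hc
  obtain ⟨hfc, g, hgc, hgf⟩ := hf
  set T := f '' closure S with hTdef
  have hgd : ∀ y ∈ closure S, HasFDerivWithinAt g (fderivWithin ℝ g T (f y)) T (f y) :=
    fun y hy => ((hgc.differentiableOn one_ne_zero) (f y) (mem_image_of_mem f hy)).hasFDerivWithinAt
  have hgcont : ContinuousOn (fun y => fderivWithin ℝ g T (f y)) (closure S) :=
    (hgc.continuousOn_fderivWithin hT le_rfl).comp hfc.continuousOn (mapsTo_image f _)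
  have hcd : ContDiffWithinAt ℝ (0 + 1) f (closure S) x := by simpa using hfc x hx
  obtain ⟨u, hu, -, -, f', hf', hf'c⟩ :=
    (contDiffWithinAt_succ_iff_hasFDerivWithinAt' (by simp)).1 hcd
  rw [insert_eq_of_mem hx] at hu
  have hxu : x ∈ u := mem_of_mem_nhdsWithin hx hu
  have hid : (fderivWithin ℝ g T (f x)).comp (f' x) = ContinuousLinearMap.id ℝ (Eu n) := by
    have hcl : x ∈ closure S := hx
    have hne' : (𝓝[S] x).NeBot := mem_closure_iff_nhdsWithin_neBot.1 hcl
    have h1 : Filter.Tendsto (fun y => (fderivWithin ℝ g T (f y)).comp (f' y)) (𝓝[S] x)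
        (𝓝 ((fderivWithin ℝ g T (f x)).comp (f' x))) := by
      have ha : ContinuousWithinAt (fun y => fderivWithin ℝ g T (f y)) S x :=
        (hgcont x hx).mono subset_closure
      have hb' : ContinuousWithinAt f' S x := hf'c.continuousWithinAt.mono subset_closure
      exact ha.clm_comp hb'
    have h2 : ∀ᶠ y in 𝓝[S] x, (fderivWithin ℝ g T (f y)).comp (f' y)
        = ContinuousLinearMap.id ℝ (Eu n) := by
      filter_upwards [nhdsWithin_mono x subset_closure hu, self_mem_nhdsWithin] with y hyu hyS
      exact comp_fderiv_eq_id_of_leftInvOn hS hyS (hgd y (subset_closure hyS)) hgf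
        ((hf' y hyu).hasFDerivAt (mem_nhds_iff.2 ⟨S, subset_closure, hS, hyS⟩))
    exact tendsto_nhds_unique h1 ((Filter.tendsto_congr' h2).2 tendsto_const_nhds)
  have hgT : g '' T = closure S := by
    rw [hTdef, ← image_comp]
    exact (image_congr (fun y hy => hgf hy)).trans (image_id' _)
  have huniq : UniqueDiffWithinAt ℝ (closure S) x := by
    have := (hgd x hx).uniqueDiffWithinAt (hT (f x) (mem_image_of_mem f hx))
      (surjective_of_comp_eq_id hid).2.denseRange
    rwa [hgT, hgf hx] at this
  refine ⟨huniq, ?_⟩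
  rw [(hf' x hxu).fderivWithin huniq]
  refine ContinuousLinearMap.IsInvertible.of_inverse (g := fderivWithin ℝ g T (f x)) ?_ hid
  ext1 v
  obtain ⟨w, rfl⟩ := (surjective_of_comp_eq_id hid).1 v
  have := congrArg (fun T : Eu n →L[ℝ] Eu n => T w) hid
  simp only [ContinuousLinearMap.comp_apply, ContinuousLinearMap.id_apply] at this ⊢
  rw [this]

end Diffeo

/-! ### Essential suprema of continuous functions -/

section Norms

/-- For a function continuous up to the boundary of an open set, the `L^∞` norm over any larger
set bounds the norm at every point. -/
theorem enorm_le_eLpNorm_top_of_continuousOn {X F : Type*} [TopologicalSpace X] [MeasurableSpace X]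
    [OpensMeasurableSpace X] {μ : Measure X} [μ.IsOpenPosMeasure] [NormedAddCommGroup F]
    {f : X → F} {O S T : Set X} (hO : IsOpen O) (hOS : O ⊆ S) (hSO : S ⊆ closure O) (hOT : O ⊆ T)
    (hf : ContinuousOn f S) {x : X} (hx : x ∈ S) :
    ‖f x‖ₑ ≤ eLpNorm f ⊤ (μ.restrict T) := by
  have key : ∀ y ∈ O, ‖f y‖ₑ ≤ eLpNorm f ⊤ (μ.restrict T) := by
    intro y hy
    by_contra! hlt
    have hcont : ContinuousOn (fun z => ‖f z‖ₑ) O := (hf.mono hOS).enorm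
    have hopen : IsOpen (O ∩ (fun z => ‖f z‖ₑ) ⁻¹' Ioi (eLpNorm f ⊤ (μ.restrict T))) :=
      hcont.isOpen_inter_preimage hO isOpen_Ioi
    have hae : ∀ᵐ z ∂(μ.restrict O), ‖f z‖ₑ ≤ eLpNorm f ⊤ (μ.restrict T) := by
      refine ae_mono (Measure.restrict_mono hOT le_rfl) ?_
      rw [eLpNorm_exponent_top]
      exact enorm_ae_le_eLpNormEssSup f _
    have hnull : μ (O ∩ (fun z => ‖f z‖ₑ) ⁻¹' Ioi (eLpNorm f ⊤ (μ.restrict T))) = 0 := by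
      have h0 := (ae_restrict_iff' hO.measurableSet).1 hae
      refine measure_mono_null ?_ (ae_iff.1 h0)
      rintro z ⟨hz, hz'⟩ h
      exact absurd (h hz) (not_le.2 hz')
    exact (hopen.measure_pos μ ⟨y, hy, hlt⟩).ne' hnull
  have hne : (𝓝[O] x).NeBot := mem_closure_iff_nhdsWithin_neBot.1 (hSO hx)
  have hlim : Filter.Tendsto (fun z => ‖f z‖ₑ) (𝓝[O] x) (𝓝 ‖f x‖ₑ) :=
    (hf.enorm x hx).mono hOS
  exact le_of_tendsto hlim (by filter_upwards [self_mem_nhdsWithin] with y hy using key y hy)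

end Norms

/-! ### A maximum principle on the unit interval -/

section RealLine

/-- A function that is convex up to a multiple of its slope, `f'' ≥ -C |f'|`, satisfies the maximum
principle: once its derivative becomes positive it stays positive. -/
theorem le_max_of_neg_mul_abs_deriv_le {f f' f'' : ℝ → ℝ} {C : ℝ}
    (hf : ∀ t ∈ Icc (0 : ℝ) 1, HasDerivAt f (f' t) t)
    (hf' : ∀ t ∈ Icc (0 : ℝ) 1, HasDerivAt f' (f'' t) t)
    (hC : ∀ t ∈ Icc (0 : ℝ) 1, -C * |f' t| ≤ f'' t) {t : ℝ} (ht : t ∈ Icc (0 : ℝ) 1) :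
    f t ≤ max (f 0) (f 1) := by
  have hcont : ContinuousOn f (Icc 0 1) := fun s hs => (hf s hs).continuousAt.continuousWithinAt
  have hcont' : ContinuousOn f' (Icc 0 1) := fun s hs => (hf' s hs).continuousAt.continuousWithinAt
  -- positivity of the slope propagates to the right
  have hprop : ∀ a ∈ Icc (0 : ℝ) 1, 0 < f' a → ∀ b ∈ Icc a 1, 0 ≤ f' b := by
    intro a ha hpos b hb
    by_contra! hneg
    have hab : a ≤ b := hb.1
    -- `m` is the first point after `a` at which the slope is not positive
    set Z := Icc a b ∩ f' ⁻¹' Iic 0 with hZ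
    have hsub : Icc a b ⊆ Icc 0 1 := Icc_subset_Icc ha.1 hb.2
    have hZc : IsClosed Z :=
      (hcont'.mono hsub).preimage_isClosed_of_isClosed isClosed_Icc isClosed_Iic
    have hZn : Z.Nonempty := ⟨b, ⟨hab, le_rfl⟩, hneg.le⟩
    have hZb : BddBelow Z := ⟨a, fun z hz => hz.1.1⟩
    set m := sInf Z with hm
    have hmZ : m ∈ Z := hZc.csInf_mem hZn hZb
    have ham : a < m :=
      lt_of_le_of_ne hmZ.1.1 (fun h => absurd hmZ.2 (by rw [← h]; simpa using hpos))
    have hposm : ∀ s ∈ Ico a m, 0 < f' s := by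
      intro s hs
      by_contra! h
      exact absurd (csInf_le hZb ⟨⟨hs.1, hs.2.le.trans hmZ.1.2⟩, h⟩) (not_le.2 hs.2)
    have hmono : MonotoneOn (fun s => Real.exp (C * s) * f' s) (Icc a m) := by
      have hd : ∀ s ∈ Icc a m, HasDerivAt (fun s => Real.exp (C * s) * f' s)
          (Real.exp (C * s) * C * f' s + Real.exp (C * s) * f'' s) s := by
        intro s hs
        have h1 : HasDerivAt (fun s : ℝ => Real.exp (C * s)) (Real.exp (C * s) * C) s := by
          simpa using ((hasDerivAt_id s).const_mul C).exp
        exact h1.mul (hf' s (hsub ⟨hs.1, hs.2.trans hmZ.1.2⟩))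
      refine monotoneOn_of_deriv_nonneg (convex_Icc a m)
        (fun s hs => (hd s hs).continuousAt.continuousWithinAt)
        (fun s hs => (hd s (interior_subset hs)).differentiableAt.differentiableWithinAt) ?_
      intro s hs
      rw [interior_Icc] at hs
      have hs' : s ∈ Icc a m := Ioo_subset_Icc_self hs
      rw [(hd s hs').deriv]
      have h2 := hC s (hsub ⟨hs'.1, hs'.2.trans hmZ.1.2⟩)
      rw [abs_of_pos (hposm s ⟨hs.1.le, hs.2⟩)] at h2
      have := Real.exp_pos (C * s)
      nlinarith [mul_nonneg this.le (by linarith : (0:ℝ) ≤ f'' s + C * f' s)]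
    have h3 := hmono (left_mem_Icc.2 ham.le) (right_mem_Icc.2 ham.le) ham.le
    have h4 : 0 < Real.exp (C * a) * f' a := mul_pos (Real.exp_pos _) hpos
    have h5 : Real.exp (C * m) * f' m ≤ 0 :=
      mul_nonpos_of_nonneg_of_nonpos (Real.exp_pos _).le hmZ.2
    simp only at h3
    linarith
  by_cases hex : ∃ a ∈ Icc 0 t, 0 < f' a
  · obtain ⟨a, ha, hpos⟩ := hex
    have ha1 : a ∈ Icc (0:ℝ) 1 := ⟨ha.1, ha.2.trans ht.2⟩
    have hsub : Icc a 1 ⊆ Icc (0:ℝ) 1 := Icc_subset_Icc ha.1 le_rfl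
    have hmono : MonotoneOn f (Icc a 1) := by
      refine monotoneOn_of_deriv_nonneg (convex_Icc a 1) (hcont.mono hsub)
        (fun s hs => (hf s (hsub (interior_subset hs))).differentiableAt.differentiableWithinAt) ?_
      intro s hs
      rw [(hf s (hsub (interior_subset hs))).deriv]
      exact hprop a ha1 hpos s (interior_subset hs)
    exact (hmono ⟨ha.2, ht.2⟩ (right_mem_Icc.2 ha1.2) ht.2).trans (le_max_right _ _)
  · push Not at hex
    have hsub : Icc 0 t ⊆ Icc (0:ℝ) 1 := Icc_subset_Icc le_rfl ht.2
    have hanti : AntitoneOn f (Icc 0 t) := by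
      refine antitoneOn_of_deriv_nonpos (convex_Icc 0 t) (hcont.mono hsub)
        (fun s hs => (hf s (hsub (interior_subset hs))).differentiableAt.differentiableWithinAt) ?_
      intro s hs
      rw [(hf s (hsub (interior_subset hs))).deriv]
      exact hex s (interior_subset hs)
    exact (hanti (left_mem_Icc.2 ht.1) (right_mem_Icc.2 ht.1) ht.1).trans (le_max_left _ _)

end RealLine

/-! ### Slopes of quasiconvex functions on ellipsoids -/

section Slope

variable {F : Type*} [NormedAddCommGroup F] [InnerProductSpace ℝ F] [CompleteSpace F]

theorem hasDerivAt_comp_add_smul {f : F → ℝ} {g : F} {a w : F} {t : ℝ}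
    (h : HasGradientAt f g (a + t • w)) :
    HasDerivAt (fun s : ℝ => f (a + s • w)) ⟪g, w⟫ t := by
  have h1 : HasDerivAt (fun s : ℝ => a + s • w) w t := by
    simpa using ((hasDerivAt_id t).smul_const w).const_add a
  have h2 := h.hasFDerivAt.comp_hasDerivAt t h1
  rw [InnerProductSpace.toDual_apply_apply] at h2
  exact h2

/-- If the gradient of `f` stays within `‖p‖ / 4` of `p` on a convex set, then the increments of
`f` over segments differ from those of the linear form `⟪p, ·⟫` by a controlled amount. -/
theorem abs_sub_sub_inner_le {f : F → ℝ} {g : F → F} {D : Set F} (hD : Convex ℝ D) {p : F}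
    (hg : ∀ q ∈ D, HasGradientAt f (g q) q ∧ ‖g q - p‖ ≤ 1 / 4 * ‖p‖) {a b : F} (ha : a ∈ D)
    (hb : b ∈ D) : |f b - f a - ⟪p, b - a⟫| ≤ 1 / 4 * ‖p‖ * ‖b - a‖ := by
  have hseg : ∀ t ∈ Icc (0 : ℝ) 1, a + t • (b - a) ∈ D := fun t ht => hD.add_smul_sub_mem ha hb ht
  have hder : ∀ t ∈ Icc (0 : ℝ) 1, HasDerivWithinAt
      (fun s : ℝ => f (a + s • (b - a)) - s * ⟪p, b - a⟫)
      (⟪g (a + t • (b - a)), b - a⟫ - ⟪p, b - a⟫) (Icc 0 1) t := by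
    intro t ht
    have h1 := hasDerivAt_comp_add_smul (hg _ (hseg t ht)).1
    have h2 : HasDerivAt (fun s : ℝ => s * ⟪p, b - a⟫) ⟪p, b - a⟫ t := by
      simpa using (hasDerivAt_id t).mul_const ⟪p, b - a⟫
    exact (h1.sub h2).hasDerivWithinAt
  have := norm_image_sub_le_of_norm_deriv_le_segment_01' hder (C := 1 / 4 * ‖p‖ * ‖b - a‖) (by
    intro t ht
    rw [← inner_sub_left]
    exact (norm_inner_le_norm _ _).trans (mul_le_mul_of_nonneg_right
      (hg _ (hseg t (Ico_subset_Icc_self ht))).2 (norm_nonneg _)))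
  simpa [Real.norm_eq_abs, sub_right_comm] using this

/-- **Slope bound.** Let `f` be quasiconvex, with gradient almost constant near `q₀`, and
nonpositive on the ellipsoid `q₀ + T(closed unit ball)`. If `f ≥ -h` somewhere in the concentric
ellipsoid of half the size, then the slope of `f` at `q₀` is bounded by `15 h` in the norm dual to
the ellipsoid.

Although `∇f` is only controlled in the Euclidean norm, a possibly eccentric ellipsoid does no
harm: moving in the direction of `p = ∇f q₀` changes `f` at the expected rate, and all other
comparisons of values of `f` are made by quasiconvexity. -/
theorem inner_le_of_quasiconvexOn {f : F → ℝ} {g : F → F} {W : Set F} {q₀ : F} {ρ h : ℝ}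
    (hf : QuasiconvexOn ℝ W f) (hball : Metric.closedBall q₀ (2 * ρ) ⊆ W)
    (hg : ∀ q ∈ Metric.closedBall q₀ (2 * ρ),
      HasGradientAt f (g q) q ∧ ‖g q - g q₀‖ ≤ 1 / 4 * ‖g q₀‖)
    {T : F →L[ℝ] F} (hT : ∀ v, ‖v‖ ≤ 1 → ‖T v‖ ≤ ρ) (hTf : ∀ v, ‖v‖ ≤ 1 → f (q₀ + T v) ≤ 0)
    {v₁ : F} (hv₁ : ‖v₁‖ ≤ 1 / 2) (hh : -h ≤ f (q₀ + T v₁)) {v : F} (hv : ‖v‖ ≤ 1) :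
    ⟪g q₀, T v⟫ ≤ 15 * h := by
  have hh0 : 0 ≤ h := by linarith [hTf v₁ (by linarith)]
  set p := g q₀ with hp
  have hρ0 : 0 ≤ ρ := by simpa using (norm_nonneg _).trans (hT 0 (by simp))
  rcases eq_or_ne p 0 with hp0 | hp0
  · simp only [hp0, inner_zero_left]; linarith
  have hpn : 0 < ‖p‖ := norm_pos_iff.2 hp0
  have hq0 : q₀ ∈ Metric.closedBall q₀ (2 * ρ) := Metric.mem_closedBall_self (by linarith)
  have hmem : ∀ w : F, ‖w‖ ≤ 2 * ρ → q₀ + w ∈ Metric.closedBall q₀ (2 * ρ) := fun w hw => by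
    simpa [Metric.mem_closedBall, dist_eq_norm] using hw
  have hlin := fun {a b : F} => abs_sub_sub_inner_le (convex_closedBall q₀ (2 * ρ)) hg (a := a)
    (b := b)
  have hqc := (quasiconvexOn_iff_le_max.1 hf).2
  have hf0 : f q₀ ≤ 0 := by simpa using hTf 0 (by simp)
  -- the value at the centre is comparable with `-h`
  have hH : -f q₀ ≤ 16 / 3 * h := by
    by_contra! hcon
    set H := -f q₀ with hHdef
    have hHpos : 0 < H := by linarith
    have h2v : ‖(2 : ℝ) • v₁‖ ≤ 1 := by rw [norm_smul, Real.norm_two]; linarith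
    have hT1 : ‖T v₁‖ ≤ ρ / 2 := by
      have := hT _ h2v
      rw [map_smul, norm_smul, Real.norm_two] at this; linarith
    have hHρ : H ≤ 5 / 4 * ‖p‖ * ρ := by
      have h1 := abs_le.1 (hlin hq0 (hmem (T v₁) (by linarith)))
      rw [add_sub_cancel_left] at h1
      have h2 : ⟪p, T v₁⟫ ≤ ‖p‖ * ‖T v₁‖ := real_inner_le_norm _ _
      have h3 : ‖p‖ * ‖T v₁‖ ≤ ‖p‖ * (ρ / 2) := mul_le_mul_of_nonneg_left hT1 hpn.le
      linarith [h1.2]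
    set s := H / (2 * ‖p‖ ^ 2) with hs
    have hspos : 0 < s := by positivity
    have hsp2 : s * ‖p‖ ^ 2 = H / 2 := by rw [hs]; field_simp
    have hsp : s * ‖p‖ ≤ 5 / 8 * ρ := by
      have : (s * ‖p‖) * ‖p‖ ≤ (5 / 8 * ρ) * ‖p‖ := by
        calc (s * ‖p‖) * ‖p‖ = H / 2 := by rw [← hsp2]; ring
          _ ≤ _ := by linarith
      exact le_of_mul_le_mul_right this hpn
    have hns : ‖s • p‖ = s * ‖p‖ := by rw [norm_smul, Real.norm_of_nonneg hspos.le]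
    have hup : f (q₀ + s • p) ≤ 0 := by
      have h1 := abs_le.1 (hlin hq0 (hmem (s • p) (by linarith)))
      rw [add_sub_cancel_left, inner_smul_right, real_inner_self_eq_norm_sq, hsp2, hns] at h1
      have : ‖p‖ * (s * ‖p‖) = H / 2 := by rw [← hsp2]; ring
      linarith [h1.2]
    have hmid : f (q₀ + T v₁ + (s / 2) • p) ≤ 0 := by
      have hW1 : q₀ + T ((2 : ℝ) • v₁) ∈ W := hball (hmem _ ((hT _ h2v).trans (by linarith)))
      have hW2 : q₀ + s • p ∈ W := hball (hmem _ (by linarith))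
      have := hqc hW1 hW2 (a := 1 / 2) (b := 1 / 2) (by norm_num) (by norm_num) (by norm_num)
      have heq : (1 / 2 : ℝ) • (q₀ + T ((2 : ℝ) • v₁)) + (1 / 2 : ℝ) • (q₀ + s • p)
          = q₀ + T v₁ + (s / 2) • p := by
        rw [map_smul]; module
      rw [heq] at this
      exact this.trans (max_le (hTf _ h2v) hup)
    have hmid' : -h + 3 / 16 * H ≤ f (q₀ + T v₁ + (s / 2) • p) := by
      have hb : q₀ + T v₁ + (s / 2) • p ∈ Metric.closedBall q₀ (2 * ρ) := by
        rw [add_assoc]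
        refine hmem _ ((norm_add_le _ _).trans ?_)
        rw [norm_smul, Real.norm_of_nonneg (by linarith)]
        linarith
      have h1 := abs_le.1 (hlin (hmem (T v₁) (by linarith)) hb)
      rw [add_sub_cancel_left, inner_smul_right, real_inner_self_eq_norm_sq, norm_smul,
        Real.norm_of_nonneg (by linarith : 0 ≤ s / 2)] at h1
      have e1 : s / 2 * ‖p‖ ^ 2 = H / 4 := by linarith
      have e2 : 1 / 4 * ‖p‖ * (s / 2 * ‖p‖) = H / 16 := by linear_combination (1 / 4) * e1
      linarith [h1.1]
    linarith
  by_contra! hcon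
  set τ := ⟪p, T v⟫ with hτ
  have hτpos : 0 < τ := by linarith
  -- half of the component of `T v` along `p` is removed: what is left still points uphill
  set s := τ / (2 * ‖p‖ ^ 2) with hs
  have hspos : 0 < s := by positivity
  have hsp2 : s * ‖p‖ ^ 2 = τ / 2 := by rw [hs]; field_simp
  set w := T v - s • p with hw
  have hTv := hT v hv
  have hns : ‖s • p‖ ≤ ρ := by
    rw [norm_smul, Real.norm_of_nonneg hspos.le]
    have h1 : τ ≤ ‖p‖ * ‖T v‖ := real_inner_le_norm _ _
    have h2 : ‖p‖ * ‖T v‖ ≤ ‖p‖ * ρ := mul_le_mul_of_nonneg_left hTv hpn.le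
    have h3 : (s * ‖p‖) * ‖p‖ ≤ ρ * ‖p‖ := by nlinarith
    exact le_of_mul_le_mul_right h3 hpn
  have hwn : ‖w‖ ≤ 2 * ρ := (norm_sub_le _ _).trans (by linarith)
  have hpw : ⟪p, w⟫ = τ / 2 := by
    rw [hw, inner_sub_right, inner_smul_right, real_inner_self_eq_norm_sq, hsp2]; ring
  have huphill : f q₀ ≤ f (q₀ + w) := by
    by_contra! hlt
    have hd := hasDerivAt_comp_add_smul (w := w) (t := 0) (a := q₀) (f := f) (g := p)
      (by simpa using (hg q₀ hq0).1)
    rw [hpw] at hd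
    have hev : ∀ᶠ t in 𝓝[>] (0 : ℝ), 0 < slope (fun s : ℝ => f (q₀ + s • w)) 0 t :=
      ((hasDerivWithinAt_iff_tendsto_slope' (by simp)).1
        (hd.hasDerivWithinAt (s := Ioi 0))).eventually (lt_mem_nhds (by linarith))
    have hle : ∀ᶠ t in 𝓝[>] (0 : ℝ), t ≤ 1 :=
      Filter.Eventually.filter_mono nhdsWithin_le_nhds (Iic_mem_nhds one_pos)
    obtain ⟨t, ht, ht1, ht0⟩ := (hev.and (hle.and self_mem_nhdsWithin)).exists
    have ht0' : (0 : ℝ) < t := ht0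
    have h1 := hqc (hball hq0) (hball (hmem w hwn)) (a := 1 - t) (b := t) (by linarith) ht0'.le
      (by ring)
    have heq : (1 - t) • q₀ + t • (q₀ + w) = q₀ + t • w := by module
    rw [heq, max_eq_left hlt.le] at h1
    rw [slope_def_field] at ht
    simp only [zero_smul, add_zero, sub_zero] at ht
    exact absurd ht (not_lt.2 (div_nonpos_of_nonpos_of_nonneg (by linarith) ht0'.le))
  have h1 := abs_le.1 (hlin (hmem w hwn) (hmem (T v) (by linarith)))
  have heq : q₀ + T v - (q₀ + w) = s • p := by rw [hw]; abel
  rw [heq, inner_smul_right, real_inner_self_eq_norm_sq, hsp2, norm_smul,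
    Real.norm_of_nonneg hspos.le] at h1
  have e2 : 1 / 4 * ‖p‖ * (s * ‖p‖) = τ / 8 := by linear_combination (1 / 4) * hsp2
  have h2 := hTf v hv
  linarith [h1.1]

end Slope

/-! ### Derivatives of the cost up to the boundary -/

section CostCalculus

variable {n : ℕ} {c : Eu n → Eu n → ℝ} {U V : Set (Eu n)}

/-- The regularity hypotheses on a cost with nonempty domains, without the curvature condition. -/
structure RegularCost (c : Eu n → Eu n → ℝ) (U V : Set (Eu n)) : Prop where
  b0 : CondB0 c U V
  b1 : CondB1 c U V
  b2 : CondB2 c U V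
  nonempty_fst : U.Nonempty
  nonempty_snd : V.Nonempty

theorem hasFDerivWithinAt_comp_mk_left {W : Type*} [NormedAddCommGroup W] [NormedSpace ℝ W]
    {F : Eu n × Eu n → W} {X Y : Set (Eu n)} {x y : Eu n} (hx : x ∈ X)
    (hF : DifferentiableWithinAt ℝ F (X ×ˢ Y) (x, y)) :
    HasFDerivWithinAt (fun y' => F (x, y')) ((fderivWithin ℝ F (X ×ˢ Y) (x, y)).comp
      (ContinuousLinearMap.inr ℝ (Eu n) (Eu n))) Y y :=
  HasFDerivWithinAt.comp (f := fun y' => (x, y')) y hF.hasFDerivWithinAt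
    (hasFDerivAt_prodMk_right x y).hasFDerivWithinAt (fun _ hy => ⟨hx, hy⟩)

theorem hasFDerivWithinAt_comp_mk_right {W : Type*} [NormedAddCommGroup W] [NormedSpace ℝ W]
    {F : Eu n × Eu n → W} {X Y : Set (Eu n)} {x y : Eu n} (hy : y ∈ Y)
    (hF : DifferentiableWithinAt ℝ F (X ×ˢ Y) (x, y)) :
    HasFDerivWithinAt (fun x' => F (x', y)) ((fderivWithin ℝ F (X ×ˢ Y) (x, y)).comp
      (ContinuousLinearMap.inl ℝ (Eu n) (Eu n))) X x :=
  HasFDerivWithinAt.comp (f := fun x' => (x', y)) x hF.hasFDerivWithinAt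
    (hasFDerivAt_prodMk_left x y).hasFDerivWithinAt (fun _ hx => ⟨hx, hy⟩)

namespace RegularCost

variable (h : RegularCost c U V)
include h

theorem isOpen_fst : IsOpen U := h.b0.1
theorem isOpen_snd : IsOpen V := h.b0.2.2.1

theorem isCompact : IsCompact (closure U ×ˢ closure V) :=
  h.b0.2.1.isCompact_closure.prod h.b0.2.2.2.1.isCompact_closure

theorem contDiffOn : ContDiffOn ℝ 4 (fun z : Eu n × Eu n => c z.1 z.2) (closure U ×ˢ closure V) :=
  h.b0.2.2.2.2

theorem image_neg_gradSnd {y : Eu n} (hy : y ∈ closure V) :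
    (fun x => -gradSnd c V x y) '' closure U = closure (domFrom c U V y) :=
  (h.b1.1 y hy).image_closure h.b0.2.1

theorem isOpen_domFrom {y : Eu n} (hy : y ∈ closure V) : IsOpen (domFrom c U V y) :=
  (h.b1.1 y hy).isOpen_image h.isOpen_fst

theorem uniqueDiffOn_domFrom {y : Eu n} (hy : y ∈ closure V) :
    UniqueDiffOn ℝ (closure (domFrom c U V y)) := by
  rw [← h.image_neg_gradSnd hy]
  exact (h.b1.1 y hy).uniqueDiffOn_image h.isOpen_fst h.nonempty_fst h.b0.2.1 (h.b2.1 y hy)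

theorem uniqueDiffOn_fst : UniqueDiffOn ℝ (closure U) := fun x hx => by
  obtain ⟨y, hy⟩ := h.nonempty_snd
  exact ((h.b1.1 y (subset_closure hy)).regular h.isOpen_fst h.b0.2.1
    (h.b2.1 y (subset_closure hy)) hx).1

theorem uniqueDiffOn_snd : UniqueDiffOn ℝ (closure V) := fun y hy => by
  obtain ⟨x, hx⟩ := h.nonempty_fst
  exact ((h.b1.2 x (subset_closure hx)).regular h.isOpen_snd h.b0.2.2.2.1
    (h.b2.2 x (subset_closure hx)) hy).1

theorem uniqueDiffOn : UniqueDiffOn ℝ (closure U ×ˢ closure V) :=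
  h.uniqueDiffOn_fst.prod h.uniqueDiffOn_snd

theorem prod_mem_nhds {z : Eu n × Eu n} (hz : z ∈ U ×ˢ V) : closure U ×ˢ closure V ∈ 𝓝 z :=
  Filter.mem_of_superset ((h.isOpen_fst.prod h.isOpen_snd).mem_nhds hz)
    (prod_mono subset_closure subset_closure)

theorem subset_closure_interior :
    closure U ×ˢ closure V ⊆ closure (interior (closure U ×ˢ closure V)) := by
  rw [← closure_prod_eq]
  exact closure_mono (interior_maximal subset_closure (h.isOpen_fst.prod h.isOpen_snd))

theorem isSymm {W : Type*} [NormedAddCommGroup W] [NormedSpace ℝ W] {F : Eu n × Eu n → W}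
    (hF : ContDiffOn ℝ 2 F (closure U ×ˢ closure V)) {z : Eu n × Eu n}
    (hz : z ∈ closure U ×ˢ closure V) (v w : Eu n × Eu n) :
    fderivWithin ℝ (fderivWithin ℝ F (closure U ×ˢ closure V)) (closure U ×ˢ closure V) z v w =
      fderivWithin ℝ (fderivWithin ℝ F (closure U ×ˢ closure V)) (closure U ×ˢ closure V) z w v :=
  (hF z hz).isSymmSndFDerivWithinAt (by simp) h.uniqueDiffOn
    (h.subset_closure_interior hz) hz v w

theorem inner_gradFst {z : Eu n × Eu n} (hz : z ∈ closure U ×ˢ closure V) (k : Eu n) :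
    ⟪gradFst c U z.1 z.2, k⟫ =
      fderivWithin ℝ (fun z : Eu n × Eu n => c z.1 z.2) (closure U ×ˢ closure V) z (k, 0) := by
  have hd := (h.contDiffOn.differentiableOn (by norm_num)) z hz
  have := (hasFDerivWithinAt_comp_mk_right (x := z.1) (y := z.2) hz.2 hd).fderivWithin
    (h.uniqueDiffOn_fst z.1 hz.1)
  rw [gradFst, inner_gradientWithin_left, this]
  simp

theorem inner_gradSnd {z : Eu n × Eu n} (hz : z ∈ closure U ×ˢ closure V) (k : Eu n) :
    ⟪gradSnd c V z.1 z.2, k⟫ =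
      fderivWithin ℝ (fun z : Eu n × Eu n => c z.1 z.2) (closure U ×ˢ closure V) z (0, k) := by
  have hd := (h.contDiffOn.differentiableOn (by norm_num)) z hz
  have := (hasFDerivWithinAt_comp_mk_left (x := z.1) (y := z.2) hz.1 hd).fderivWithin
    (h.uniqueDiffOn_snd z.2 hz.2)
  rw [gradSnd, inner_gradientWithin_left, this]
  simp

theorem contDiffOn_fderivWithin : ContDiffOn ℝ 3
    (fderivWithin ℝ (fun z : Eu n × Eu n => c z.1 z.2) (closure U ×ˢ closure V))
    (closure U ×ˢ closure V) :=
  h.contDiffOn.fderivWithin h.uniqueDiffOn (by norm_num)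

theorem contDiffOn_hessian : ContDiffOn ℝ 2 (fderivWithin ℝ
    (fderivWithin ℝ (fun z : Eu n × Eu n => c z.1 z.2) (closure U ×ˢ closure V))
    (closure U ×ˢ closure V)) (closure U ×ˢ closure V) :=
  h.contDiffOn_fderivWithin.fderivWithin h.uniqueDiffOn (by norm_num)

theorem contDiffOn_gradFst :
    ContDiffOn ℝ 3 (fun z : Eu n × Eu n => gradFst c U z.1 z.2) (closure U ×ˢ closure V) := by
  rw [contDiffOn_euclidean]
  intro i
  refine (h.contDiffOn_fderivWithin.clm_apply
    (contDiffOn_const (c := (EuclideanSpace.single i (1 : ℝ), (0 : Eu n))))).congr fun z hz => ?_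
  rw [← h.inner_gradFst hz, EuclideanSpace.inner_single_right]
  simp

theorem contDiffOn_gradSnd :
    ContDiffOn ℝ 3 (fun z : Eu n × Eu n => gradSnd c V z.1 z.2) (closure U ×ˢ closure V) := by
  rw [contDiffOn_euclidean]
  intro i
  refine (h.contDiffOn_fderivWithin.clm_apply
    (contDiffOn_const (c := ((0 : Eu n), EuclideanSpace.single i (1 : ℝ))))).congr fun z hz => ?_
  rw [← h.inner_gradSnd hz, EuclideanSpace.inner_single_right]
  simp

theorem hasFDerivWithinAt_gradFst {z : Eu n × Eu n} (hz : z ∈ closure U ×ˢ closure V) :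
    HasFDerivWithinAt (fun y => gradFst c U z.1 y) (mixedHessian c U V z.1 z.2) (closure V) z.2 :=
  (hasFDerivWithinAt_comp_mk_left (x := z.1) (y := z.2) hz.1
    ((h.contDiffOn_gradFst.differentiableOn (by norm_num)) z
      hz)).differentiableWithinAt.hasFDerivWithinAt

theorem mixedHessian_eq {z : Eu n × Eu n} (hz : z ∈ closure U ×ˢ closure V) :
    mixedHessian c U V z.1 z.2 =
      (fderivWithin ℝ (fun z : Eu n × Eu n => gradFst c U z.1 z.2) (closure U ×ˢ closure V) z).comp
        (ContinuousLinearMap.inr ℝ (Eu n) (Eu n)) :=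
  (hasFDerivWithinAt_comp_mk_left (x := z.1) (y := z.2) hz.1
    ((h.contDiffOn_gradFst.differentiableOn (by norm_num)) z hz)).fderivWithin
      (h.uniqueDiffOn_snd z.2 hz.2)

/-- Differentiating `⟪D_x c, k⟫ = Dc(k, 0)`. -/
theorem inner_fderivWithin_gradFst {z : Eu n × Eu n} (hz : z ∈ closure U ×ˢ closure V)
    (w : Eu n × Eu n) (k : Eu n) :
    ⟪fderivWithin ℝ (fun z : Eu n × Eu n => gradFst c U z.1 z.2) (closure U ×ˢ closure V) z w, k⟫ =
      fderivWithin ℝ (fderivWithin ℝ (fun z : Eu n × Eu n => c z.1 z.2) (closure U ×ˢ closure V))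
        (closure U ×ˢ closure V) z w (k, 0) := by
  have h1 := ((h.contDiffOn_gradFst.differentiableOn (by norm_num)) z hz).hasFDerivWithinAt.inner ℝ
    (hasFDerivWithinAt_const k z _)
  have h2 := ((h.contDiffOn_fderivWithin.differentiableOn (by norm_num)) z
    hz).hasFDerivWithinAt.clm_apply (hasFDerivWithinAt_const ((k, 0) : Eu n × Eu n) z _)
  have h3 := h2.congr (f₁ := fun z : Eu n × Eu n => ⟪gradFst c U z.1 z.2, k⟫)
    (fun w hw => h.inner_gradFst hw k) (h.inner_gradFst hz k)
  have := congrArg (fun T : Eu n × Eu n →L[ℝ] ℝ => T w) ((h.uniqueDiffOn z hz).eq h1 h3)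
  simpa [fderivInnerCLM_apply] using this

theorem inner_fderivWithin_gradSnd {z : Eu n × Eu n} (hz : z ∈ closure U ×ˢ closure V)
    (w : Eu n × Eu n) (k : Eu n) :
    ⟪fderivWithin ℝ (fun z : Eu n × Eu n => gradSnd c V z.1 z.2) (closure U ×ˢ closure V) z w, k⟫ =
      fderivWithin ℝ (fderivWithin ℝ (fun z : Eu n × Eu n => c z.1 z.2) (closure U ×ˢ closure V))
        (closure U ×ˢ closure V) z w (0, k) := by
  have h1 := ((h.contDiffOn_gradSnd.differentiableOn (by norm_num)) z hz).hasFDerivWithinAt.inner ℝ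
    (hasFDerivWithinAt_const k z _)
  have h2 := ((h.contDiffOn_fderivWithin.differentiableOn (by norm_num)) z
    hz).hasFDerivWithinAt.clm_apply (hasFDerivWithinAt_const ((0, k) : Eu n × Eu n) z _)
  have h3 := h2.congr (f₁ := fun z : Eu n × Eu n => ⟪gradSnd c V z.1 z.2, k⟫)
    (fun w hw => h.inner_gradSnd hw k) (h.inner_gradSnd hz k)
  have := congrArg (fun T : Eu n × Eu n →L[ℝ] ℝ => T w) ((h.uniqueDiffOn z hz).eq h1 h3)
  simpa [fderivInnerCLM_apply] using this

theorem inner_mixedHessian {z : Eu n × Eu n} (hz : z ∈ closure U ×ˢ closure V) (l k : Eu n) :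
    ⟪mixedHessian c U V z.1 z.2 l, k⟫ =
      fderivWithin ℝ (fderivWithin ℝ (fun z : Eu n × Eu n => c z.1 z.2) (closure U ×ˢ closure V))
        (closure U ×ˢ closure V) z (0, l) (k, 0) := by
  rw [h.mixedHessian_eq hz, ← h.inner_fderivWithin_gradFst hz]
  simp

theorem contDiffOn_mixedHessian : ContDiffOn ℝ 2
    (fun z : Eu n × Eu n => mixedHessian c U V z.1 z.2) (closure U ×ˢ closure V) := by
  have h1 := h.contDiffOn_gradFst.fderivWithin (m := 2) h.uniqueDiffOn (by norm_num)
  exact (h1.clm_comp (contDiffOn_const (c := ContinuousLinearMap.inr ℝ (Eu n) (Eu n)))).congr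
    fun z hz => h.mixedHessian_eq hz

theorem hasFDerivWithinAt_mixedHessian {z : Eu n × Eu n} (hz : z ∈ closure U ×ˢ closure V) :
    HasFDerivWithinAt (fun x => mixedHessian c U V x z.2) (mixedThird c U V z.1 z.2)
      (closure U) z.1 :=
  (hasFDerivWithinAt_comp_mk_right (x := z.1) (y := z.2) hz.2
    ((h.contDiffOn_mixedHessian.differentiableOn (by norm_num)) z
      hz)).differentiableWithinAt.hasFDerivWithinAt

theorem continuousOn_mixedThird : ContinuousOn
    (fun z : Eu n × Eu n => mixedThird c U V z.1 z.2) (closure U ×ˢ closure V) := by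
  have h1 := h.contDiffOn_mixedHessian.fderivWithin (m := 1) h.uniqueDiffOn (by norm_num)
  refine (h1.continuousOn.clm_comp
    (continuousOn_const (c := ContinuousLinearMap.inl ℝ (Eu n) (Eu n)))).congr fun z hz => ?_
  exact (hasFDerivWithinAt_comp_mk_right (x := z.1) (y := z.2) hz.2
    ((h.contDiffOn_mixedHessian.differentiableOn (by norm_num)) z hz)).fderivWithin
      (h.uniqueDiffOn_fst z.1 hz.1)

/-- The derivative of `x ↦ D_y c(x, y)` is the transpose of the mixed Hessian. -/
theorem hasFDerivWithinAt_gradSnd {z : Eu n × Eu n} (hz : z ∈ closure U ×ˢ closure V) :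
    HasFDerivWithinAt (fun x => gradSnd c V x z.2)
      (ContinuousLinearMap.adjoint (mixedHessian c U V z.1 z.2)) (closure U) z.1 := by
  have h1 := hasFDerivWithinAt_comp_mk_right (x := z.1) (y := z.2) hz.2
    ((h.contDiffOn_gradSnd.differentiableOn (by norm_num)) z hz)
  suffices heq : ContinuousLinearMap.adjoint (mixedHessian c U V z.1 z.2) =
      (fderivWithin ℝ (fun z : Eu n × Eu n => gradSnd c V z.1 z.2) (closure U ×ˢ closure V) z).comp
        (ContinuousLinearMap.inl ℝ (Eu n) (Eu n)) by
    rw [heq]; exact h1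
  ext1 k
  refine ext_inner_right ℝ fun l => ?_
  rw [ContinuousLinearMap.adjoint_inner_left, real_inner_comm, h.inner_mixedHessian hz,
    h.isSymm (h.contDiffOn.of_le (by norm_num)) hz]
  have := h.inner_fderivWithin_gradSnd hz (k, 0) l
  simpa using this.symm

theorem isInvertible_mixedHessian {z : Eu n × Eu n} (hz : z ∈ closure U ×ˢ closure V) :
    (mixedHessian c U V z.1 z.2).IsInvertible := by
  have h1 := ((h.b1.2 z.1 hz.1).regular h.isOpen_snd h.b0.2.2.2.1 (h.b2.2 z.1 hz.1) hz.2).2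
  have h2 : fderivWithin ℝ (fun y => -gradFst c U z.1 y) (closure V) z.2 = _ :=
    ((h.hasFDerivWithinAt_gradFst hz).neg).fderivWithin (h.uniqueDiffOn_snd z.2 hz.2)
  rw [h2] at h1
  obtain ⟨e, he⟩ := h1
  refine ⟨e.trans (ContinuousLinearEquiv.neg ℝ), ?_⟩
  ext1 v
  have := congrArg (fun T : Eu n →L[ℝ] Eu n => T v) he
  simp only [ContinuousLinearEquiv.coe_coe, neg_apply] at this
  simp [this]

theorem contDiffOn_inverse : ContDiffOn ℝ 2
    (fun z : Eu n × Eu n => (mixedHessian c U V z.1 z.2).inverse) (closure U ×ˢ closure V) :=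
  fun z hz => ContDiffAt.comp_contDiffWithinAt (g := ContinuousLinearMap.inverse) z
    ((h.isInvertible_mixedHessian hz).contDiffAt_map_inverse) (h.contDiffOn_mixedHessian z hz)

end RegularCost

end CostCalculus

/-! ### Directional derivatives within a set -/

section DirectionalDerivatives

variable {X W : Type*} [NormedAddCommGroup X] [NormedSpace ℝ X] [NormedAddCommGroup W]
  [NormedSpace ℝ W] {K : Set X} {F : X → W}

/-- The derivative of `F` within `K` in the constant direction `w`. -/
def dirDeriv (K : Set X) (w : X) (F : X → W) (z : X) : W := fderivWithin ℝ F K z w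

/-- The second order operator `F ↦ D²F(v, v) + DF(a)`, which is `(F ∘ γ)''` at a parameter where
the curve `γ` has velocity `v` and acceleration `a`. -/
def secondOrder (K : Set X) (v a : X) (F : X → W) (z : X) : W :=
  dirDeriv K v (dirDeriv K v F) z + dirDeriv K a F z

theorem contDiffOn_dirDeriv (hK : UniqueDiffOn ℝ K) {m k : ℕ∞ω} (hF : ContDiffOn ℝ k F K)
    (hmk : m + 1 ≤ k) (w : X) : ContDiffOn ℝ m (dirDeriv K w F) K :=
  (hF.fderivWithin hK hmk).clm_apply contDiffOn_const

theorem contDiffOn_secondOrder (hK : UniqueDiffOn ℝ K) {m k : ℕ∞ω} (hF : ContDiffOn ℝ k F K)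
    (hmk : m + 1 + 1 ≤ k) (v a : X) : ContDiffOn ℝ m (secondOrder K v a F) K :=
  (contDiffOn_dirDeriv hK (contDiffOn_dirDeriv hK hF hmk v) le_rfl v).add
    (contDiffOn_dirDeriv hK hF ((add_le_add_left le_self_add 1).trans hmk) a)

theorem dirDeriv_congr {G : X → W} (hFG : EqOn F G K) {z : X} (hz : z ∈ K) (w : X) :
    dirDeriv K w F z = dirDeriv K w G z := by
  rw [dirDeriv, dirDeriv, fderivWithin_congr hFG (hFG hz)]

theorem dirDeriv_dirDeriv (hK : UniqueDiffOn ℝ K) (hF : ContDiffOn ℝ 2 F K) {z : X} (hz : z ∈ K)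
    (u w : X) :
    dirDeriv K u (dirDeriv K w F) z = fderivWithin ℝ (fderivWithin ℝ F K) K z u w := by
  have h1 := ((hF.fderivWithin (m := 1) hK (by norm_num)).differentiableOn one_ne_zero z hz)
  have h2 := (h1.hasFDerivWithinAt.clm_apply (hasFDerivWithinAt_const w z K)).fderivWithin (hK z hz)
  have h3 : fderivWithin ℝ (dirDeriv K w F) K z = _ := h2
  rw [dirDeriv, h3]
  simp

theorem dirDeriv_comm (hK : UniqueDiffOn ℝ K) (hK' : K ⊆ closure (interior K))
    (hF : ContDiffOn ℝ 2 F K) {z : X} (hz : z ∈ K) (u w : X) :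
    dirDeriv K u (dirDeriv K w F) z = dirDeriv K w (dirDeriv K u F) z := by
  rw [dirDeriv_dirDeriv hK hF hz, dirDeriv_dirDeriv hK hF hz]
  exact (hF z hz).isSymmSndFDerivWithinAt (by simp) hK (hK' hz) hz u w

theorem dirDeriv_secondOrder (hK : UniqueDiffOn ℝ K) (hK' : K ⊆ closure (interior K))
    (hF : ContDiffOn ℝ 3 F K) {z : X} (hz : z ∈ K) (w v a : X) :
    dirDeriv K w (secondOrder K v a F) z = secondOrder K v a (dirDeriv K w F) z := by
  have hF2 : ContDiffOn ℝ 2 F K := hF.of_le (by norm_num)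
  have hv : ContDiffOn ℝ 2 (dirDeriv K v F) K := contDiffOn_dirDeriv hK hF (by norm_num) v
  have h1 : DifferentiableWithinAt ℝ (dirDeriv K v (dirDeriv K v F)) K z :=
    (contDiffOn_dirDeriv (m := 1) hK hv (by norm_num) v).differentiableOn one_ne_zero z hz
  have h2 : DifferentiableWithinAt ℝ (dirDeriv K a F) K z :=
    (contDiffOn_dirDeriv (m := 1) hK hF2 (by norm_num) a).differentiableOn one_ne_zero z hz
  have h3 : dirDeriv K w (secondOrder K v a F) z
      = dirDeriv K w (dirDeriv K v (dirDeriv K v F)) z + dirDeriv K w (dirDeriv K a F) z := by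
    have := fderivWithin_add (hK z hz) h1 h2
    have h4 : fderivWithin ℝ (secondOrder K v a F) K z = _ := this
    rw [dirDeriv, h4]
    rfl
  rw [h3, secondOrder, dirDeriv_comm hK hK' hv hz w v, dirDeriv_comm hK hK' hF2 hz w a]
  congr 1
  exact dirDeriv_congr (fun y hy => dirDeriv_comm hK hK' hF2 hy w v) hz v

theorem hasDerivAt_comp_of_contDiffOn {k : ℕ∞ω} (hk : k ≠ 0) (hF : ContDiffOn ℝ k F K)
    {γ : ℝ → X} {γ₁ : X} {t : ℝ} (hγ : HasDerivAt γ γ₁ t) (ht : K ∈ 𝓝 (γ t)) :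
    HasDerivAt (fun s => F (γ s)) (fderivWithin ℝ F K (γ t) γ₁) t := by
  have h1 := ((hF.differentiableOn hk) (γ t) (mem_of_mem_nhds ht)).hasFDerivWithinAt.hasFDerivAt ht
  exact h1.comp_hasDerivAt t hγ

/-- Second order chain rule along a curve. -/
theorem hasDerivAt_fderivWithin_comp (hK : UniqueDiffOn ℝ K) (hF : ContDiffOn ℝ 2 F K)
    {γ γ₁ : ℝ → X} {a : X} {t : ℝ} (hγ : HasDerivAt γ (γ₁ t) t) (hγ₁ : HasDerivAt γ₁ a t)
    (ht : K ∈ 𝓝 (γ t)) :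
    HasDerivAt (fun s => fderivWithin ℝ F K (γ s) (γ₁ s)) (secondOrder K (γ₁ t) a F (γ t)) t := by
  have h1 := hasDerivAt_comp_of_contDiffOn one_ne_zero
    (hF.fderivWithin (m := 1) hK (by norm_num)) hγ ht
  have h2 := h1.clm_apply hγ₁
  rwa [← dirDeriv_dirDeriv hK hF (mem_of_mem_nhds ht)] at h2

theorem iteratedDeriv_two_eq {f f₁ : ℝ → W} {f₂ : W} {t : ℝ}
    (h₁ : ∀ᶠ s in 𝓝 t, HasDerivAt f (f₁ s) s) (h₂ : HasDerivAt f₁ f₂ t) :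
    iteratedDeriv 2 f t = f₂ := by
  rw [iteratedDeriv_succ, iteratedDeriv_one]
  have : deriv f =ᶠ[𝓝 t] f₁ := h₁.mono fun s hs => hs.deriv
  rw [this.deriv_eq, h₂.deriv]

theorem iteratedDeriv_two_comp (hK : UniqueDiffOn ℝ K) (hF : ContDiffOn ℝ 2 F K)
    {γ γ₁ : ℝ → X} {a : X} {t : ℝ} (hγ : ∀ᶠ s in 𝓝 t, HasDerivAt γ (γ₁ s) s)
    (hγ₁ : HasDerivAt γ₁ a t) (ht : K ∈ 𝓝 (γ t)) :
    iteratedDeriv 2 (fun s => F (γ s)) t = secondOrder K (γ₁ t) a F (γ t) := by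
  refine iteratedDeriv_two_eq ?_ (hasDerivAt_fderivWithin_comp hK hF hγ.self_of_nhds hγ₁ ht)
  have hint : ∀ᶠ s in 𝓝 t, K ∈ 𝓝 (γ s) :=
    hγ.self_of_nhds.continuousAt.eventually (eventually_mem_nhds_iff.2 ht)
  filter_upwards [hγ, hint] with s hs hs'
  exact hasDerivAt_comp_of_contDiffOn two_ne_zero hF hs hs'

end DirectionalDerivatives

/-! ### Segments with respect to a cost -/

section Segments

variable {n : ℕ}

/-- Preimages of affinely parameterized segments under a diffeomorphism are differentiable curves,
up to the ends of the parameter set. -/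
theorem IsDiffeoOntoImage.exists_curve {f : Eu n → Eu n} {S : Set (Eu n)}
    (hf : IsDiffeoOntoImage f S) {f' finv : Eu n → Eu n →L[ℝ] Eu n}
    (hf' : ∀ x ∈ S, HasFDerivWithinAt f (f' x) S x) (hinv : ∀ x ∈ S, ∀ v, finv x (f' x v) = v)
    {I : Set ℝ} (hI : UniqueDiffOn ℝ I) {p w : Eu n} (hp : ∀ s ∈ I, p + s • w ∈ f '' S) :
    ∃ γ : ℝ → Eu n, ∀ s ∈ I, γ s ∈ S ∧ f (γ s) = p + s • w ∧
      HasDerivWithinAt γ (finv (γ s) w) I s := by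
  obtain ⟨-, g, hg, hgf⟩ := hf
  refine ⟨fun s => g (p + s • w), fun s hs => ?_⟩
  have hmem : ∀ s ∈ I, g (p + s • w) ∈ S ∧ f (g (p + s • w)) = p + s • w := by
    intro s hs
    obtain ⟨x, hx, hfx⟩ := hp s hs
    rw [← hfx, hgf hx]
    exact ⟨hx, rfl⟩
  refine ⟨(hmem s hs).1, (hmem s hs).2, ?_⟩
  have hline : HasDerivWithinAt (fun s : ℝ => p + s • w) w I s := by
    simpa using (((hasDerivAt_id s).smul_const w).const_add p).hasDerivWithinAt
  have hd : HasDerivWithinAt (fun s : ℝ => g (p + s • w))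
      (fderivWithin ℝ g (f '' S) (p + s • w) w) I s :=
    ((hg.differentiableOn one_ne_zero) _ (hp s hs)).hasFDerivWithinAt.comp_hasDerivWithinAt s hline
      hp
  have hd2 := (hf' _ (hmem s hs).1).comp_hasDerivWithinAt s hd (fun t ht => (hmem t ht).1)
  have hd3 := hline.congr (f₁ := f ∘ fun s : ℝ => g (p + s • w)) (fun t ht => (hmem t ht).2)
    (hmem s hs).2
  have := (hI s hs).eq_deriv _ hd2 hd3
  have h2 := hinv _ (hmem s hs).1 (fderivWithin ℝ g (f '' S) (p + s • w) w)
  rw [this] at h2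
  rw [h2]
  exact hd

variable {c : Eu n → Eu n → ℝ} {U V : Set (Eu n)}

namespace RegularCost

variable (h : RegularCost c U V)
include h

theorem inverse_mixedHessian_apply {x y : Eu n} (hx : x ∈ closure U) (hy : y ∈ closure V)
    (v : Eu n) : (mixedHessian c U V x y).inverse (mixedHessian c U V x y v) = v :=
  (h.isInvertible_mixedHessian (z := (x, y)) ⟨hx, hy⟩).inverse_apply_self v

theorem mixedHessian_inverse_apply {x y : Eu n} (hx : x ∈ closure U) (hy : y ∈ closure V)
    (v : Eu n) : mixedHessian c U V x y ((mixedHessian c U V x y).inverse v) = v :=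
  (h.isInvertible_mixedHessian (z := (x, y)) ⟨hx, hy⟩).self_apply_inverse v

theorem adjoint_inverse_apply {x y : Eu n} (hx : x ∈ closure U) (hy : y ∈ closure V) (v : Eu n) :
    ContinuousLinearMap.adjoint (mixedHessian c U V x y).inverse
      (ContinuousLinearMap.adjoint (mixedHessian c U V x y) v) = v := by
  refine ext_inner_right ℝ fun w => ?_
  rw [ContinuousLinearMap.adjoint_inner_left, ContinuousLinearMap.adjoint_inner_left,
    h.mixedHessian_inverse_apply hx hy]

/-- Segments with respect to a point `x`: curves `y(s)` for which `-D_x c(x, y(s))` is affine. -/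
theorem exists_curve_snd {x : Eu n} (hx : x ∈ closure U) {I : Set ℝ} (hI : UniqueDiffOn ℝ I)
    {p w : Eu n} (hp : ∀ s ∈ I, p + s • w ∈ (fun y => -gradFst c U x y) '' closure V) :
    ∃ γ : ℝ → Eu n, ∀ s ∈ I, γ s ∈ closure V ∧ -gradFst c U x (γ s) = p + s • w ∧
      HasDerivWithinAt γ (-(mixedHessian c U V x (γ s)).inverse w) I s := by
  refine (h.b1.2 x hx).exists_curve (f' := fun y => -mixedHessian c U V x y)
    (finv := fun y => -(mixedHessian c U V x y).inverse)
    (fun y hy => (h.hasFDerivWithinAt_gradFst (z := (x, y)) ⟨hx, hy⟩).neg)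
    (fun y hy v => ?_) hI hp
  simp [h.inverse_mixedHessian_apply hx hy]

/-- Segments with respect to a point `y`: curves `x(t)` for which `-D_y c(x(t), y)` is affine. -/
theorem exists_curve_fst {y : Eu n} (hy : y ∈ closure V) {I : Set ℝ} (hI : UniqueDiffOn ℝ I)
    {p w : Eu n} (hp : ∀ s ∈ I, p + s • w ∈ (fun x => -gradSnd c V x y) '' closure U) :
    ∃ γ : ℝ → Eu n, ∀ s ∈ I, γ s ∈ closure U ∧ -gradSnd c V (γ s) y = p + s • w ∧
      HasDerivWithinAt γ
        (-ContinuousLinearMap.adjoint (mixedHessian c U V (γ s) y).inverse w) I s := by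
  refine (h.b1.1 y hy).exists_curve
    (f' := fun x => -ContinuousLinearMap.adjoint (mixedHessian c U V x y))
    (finv := fun x => -ContinuousLinearMap.adjoint (mixedHessian c U V x y).inverse)
    (fun x hx => (h.hasFDerivWithinAt_gradSnd (z := (x, y)) ⟨hx, hy⟩).neg)
    (fun x hx v => ?_) hI hp
  simp [h.adjoint_inverse_apply hx hy]

theorem injOn_gradFst {x : Eu n} (hx : x ∈ closure U) :
    InjOn (fun y => -gradFst c U x y) (closure V) := by
  obtain ⟨-, g, -, hg⟩ := h.b1.2 x hx
  exact hg.injOn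

theorem injOn_gradSnd {y : Eu n} (hy : y ∈ closure V) :
    InjOn (fun x => -gradSnd c V x y) (closure U) := by
  obtain ⟨-, g, -, hg⟩ := h.b1.1 y hy
  exact hg.injOn

theorem mem_fst_of_mem_domFrom {x y : Eu n} (hx : x ∈ closure U) (hy : y ∈ closure V)
    (hxy : -gradSnd c V x y ∈ domFrom c U V y) : x ∈ U := by
  obtain ⟨x', hx', heq⟩ := hxy
  rwa [← h.injOn_gradSnd hy (subset_closure hx') hx heq]

theorem isOpen_codomFrom {x : Eu n} (hx : x ∈ closure U) : IsOpen (codomFrom c U V x) :=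
  (h.b1.2 x hx).isOpen_image h.isOpen_snd

theorem image_neg_gradFst {x : Eu n} (hx : x ∈ closure U) :
    (fun y => -gradFst c U x y) '' closure V = closure (codomFrom c U V x) :=
  (h.b1.2 x hx).image_closure h.b0.2.2.2.1

end RegularCost

variable {W : Type*} [NormedAddCommGroup W] [NormedSpace ℝ W]

/-- The derivative of `F` at `(x, y)` in the second variable, expressed in the coordinates
`-D_x c(x, ·)`, in which segments with respect to `x` are straight lines. -/
def segDeriv (c : Eu n → Eu n → ℝ) (U V : Set (Eu n)) (F : Eu n × Eu n → W) (z : Eu n × Eu n) :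
    Eu n →L[ℝ] W :=
  (fderivWithin ℝ F (closure U ×ˢ closure V) z).comp
    ((ContinuousLinearMap.inr ℝ (Eu n) (Eu n)).comp (-(mixedHessian c U V z.1 z.2).inverse))

namespace RegularCost

variable (h : RegularCost c U V)
include h

theorem contDiffOn_segDeriv {F : Eu n × Eu n → W} {m k : ℕ∞ω}
    (hF : ContDiffOn ℝ k F (closure U ×ˢ closure V)) (hmk : m + 1 ≤ k) (hm : m ≤ 2) :
    ContDiffOn ℝ m (segDeriv c U V F) (closure U ×ˢ closure V) :=
  (hF.fderivWithin h.uniqueDiffOn hmk).clm_comp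
    (contDiffOn_const.clm_comp (h.contDiffOn_inverse.of_le hm).neg)

end RegularCost

theorem hasDerivWithinAt_segDeriv {F : Eu n × Eu n → W} {k : ℕ∞ω} (hk : k ≠ 0)
    (hF : ContDiffOn ℝ k F (closure U ×ˢ closure V)) {x : Eu n} (hx : x ∈ closure U) {I : Set ℝ}
    {γ : ℝ → Eu n} (hγ : ∀ s ∈ I, γ s ∈ closure V) {w : Eu n} {s : ℝ} (hs : s ∈ I)
    (hγ' : HasDerivWithinAt γ (-(mixedHessian c U V x (γ s)).inverse w) I s) :
    HasDerivWithinAt (fun s => F (x, γ s)) (segDeriv c U V F (x, γ s) w) I s := by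
  have h1 := hasFDerivWithinAt_comp_mk_left hx ((hF.differentiableOn hk) (x, γ s) ⟨hx, hγ s hs⟩)
  exact h1.comp_hasDerivWithinAt s hγ' hγ

end Segments

/-! ### The cross-curvature -/

section Curvature

variable {n : ℕ} {c : Eu n → Eu n → ℝ} {U V : Set (Eu n)}

/-- The full second derivative `D²c` on `closure U × closure V`. -/
def costHessian (c : Eu n → Eu n → ℝ) (U V : Set (Eu n)) (z : Eu n × Eu n) :
    Eu n × Eu n →L[ℝ] Eu n × Eu n →L[ℝ] ℝ :=
  fderivWithin ℝ (fderivWithin ℝ (fun z : Eu n × Eu n => c z.1 z.2) (closure U ×ˢ closure V))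
    (closure U ×ˢ closure V) z

/-- The second derivative of `D²c` along segments with respect to `x`; its entry
`(η, η, (ξ, 0), (ξ, 0))` is the negative of the cross-curvature. -/
def segHessian (c : Eu n → Eu n → ℝ) (U V : Set (Eu n)) (z : Eu n × Eu n) :
    Eu n →L[ℝ] Eu n →L[ℝ] Eu n × Eu n →L[ℝ] Eu n × Eu n →L[ℝ] ℝ :=
  segDeriv c U V (segDeriv c U V (costHessian c U V)) z

theorem exists_smul_forall_mem {O : Set (Eu n)} (hO : IsOpen O) {p : Eu n} (hp : p ∈ O) (w : Eu n) :
    ∃ κ : ℝ, 0 < κ ∧ ∀ t ∈ Icc (-1 : ℝ) 1, p + t • (κ • w) ∈ O := by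
  obtain ⟨ε, hε, hball⟩ := Metric.isOpen_iff.1 hO p hp
  refine ⟨ε / (‖w‖ + 1), by positivity, fun t ht => hball ?_⟩
  have hw : 0 < ‖w‖ + 1 := by positivity
  rw [mem_ball_iff_norm, add_sub_cancel_left, norm_smul, norm_smul,
    Real.norm_of_nonneg (by positivity : 0 ≤ ε / (‖w‖ + 1)), Real.norm_eq_abs]
  calc |t| * (ε / (‖w‖ + 1) * ‖w‖) ≤ 1 * (ε / (‖w‖ + 1) * ‖w‖) :=
        mul_le_mul_of_nonneg_right (abs_le.2 ht) (by positivity)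
    _ < ε := by
        rw [one_mul, div_mul_eq_mul_div, div_lt_iff₀ hw]
        exact mul_lt_mul_of_pos_left (by linarith) hε

theorem differentiableAt_adjoint_apply {G : ℝ → Eu n →L[ℝ] Eu n} {t : ℝ}
    (hG : DifferentiableAt ℝ G t) (w : Eu n) :
    DifferentiableAt ℝ (fun s => ContinuousLinearMap.adjoint (G s) w) t := by
  rw [differentiableAt_euclidean]
  intro i
  have h1 : DifferentiableAt ℝ (fun s => ⟪w, G s (EuclideanSpace.single i (1 : ℝ))⟫) t :=
    (differentiableAt_const w).inner ℝ (hG.clm_apply (differentiableAt_const _))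
  refine h1.congr_of_eventuallyEq (Filter.Eventually.of_forall fun s => ?_)
  change _ = ⟪w, G s (EuclideanSpace.single i (1 : ℝ))⟫
  rw [← ContinuousLinearMap.adjoint_inner_left, EuclideanSpace.inner_single_right]
  simp

namespace RegularCost

variable (h : RegularCost c U V)
include h

theorem contDiffOn_costHessian : ContDiffOn ℝ 2 (costHessian c U V) (closure U ×ˢ closure V) :=
  h.contDiffOn_hessian

theorem contDiffOn_segDeriv_costHessian :
    ContDiffOn ℝ 1 (segDeriv c U V (costHessian c U V)) (closure U ×ˢ closure V) :=
  h.contDiffOn_segDeriv h.contDiffOn_costHessian (by norm_num) (by norm_num)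

theorem continuousOn_segHessian :
    ContinuousOn (segHessian c U V) (closure U ×ˢ closure V) :=
  (h.contDiffOn_segDeriv (m := 0) h.contDiffOn_segDeriv_costHessian (by norm_num)
    (by norm_num)).continuousOn

theorem dirDeriv_cost_fst {z : Eu n × Eu n} (hz : z ∈ closure U ×ˢ closure V) (w : Eu n) :
    dirDeriv (closure U ×ˢ closure V) (w, 0) (fun z : Eu n × Eu n => c z.1 z.2) z =
      ⟪gradFst c U z.1 z.2, w⟫ :=
  (h.inner_gradFst hz w).symm

set_option maxHeartbeats 400000 in
/-- The fourth order derivative in condition (B3), for curves which are segments with respect to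
each other's base points, depends only on the initial velocities of the curves. -/
theorem segHessian_eq_iteratedDeriv {x y : ℝ → Eu n} {ζ w : Eu n} (hx0 : x 0 ∈ U) (hy0 : y 0 ∈ V)
    (hx : ∀ s ∈ Icc (-1 : ℝ) 1, x s ∈ closure U ∧ HasDerivWithinAt x
        (-ContinuousLinearMap.adjoint (mixedHessian c U V (x s) (y 0)).inverse ζ) (Icc (-1) 1) s)
    (hy : ∀ t ∈ Icc (-1 : ℝ) 1, y t ∈ closure V ∧ HasDerivWithinAt y
        (-(mixedHessian c U V (x 0) (y t)).inverse w) (Icc (-1) 1) t)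
    (hyA : ∃ p, ∀ t ∈ Icc (-1 : ℝ) 1, -gradFst c U (x 0) (y t) = p + t • w) {ξ : Eu n}
    (hξ : -ContinuousLinearMap.adjoint (mixedHessian c U V (x 0) (y 0)).inverse ζ = ξ) :
    deriv (fun s : ℝ => deriv (fun t : ℝ => c (x s) (y t)) 0) 0 = -⟪w, ξ⟫ ∧
    iteratedDeriv 2 (fun s : ℝ => iteratedDeriv 2 (fun t : ℝ => c (x s) (y t)) 0) 0 =
      segHessian c U V (x 0, y 0) w w (ξ, 0) (ξ, 0) := by
  obtain ⟨p, hyA⟩ := hyA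
  set K := closure U ×ˢ closure V with hK
  set C : Eu n × Eu n → ℝ := fun z => c z.1 z.2 with hC
  have hKu : UniqueDiffOn ℝ K := h.uniqueDiffOn
  have hKc := h.subset_closure_interior
  have hCd : ContDiffOn ℝ 4 C K := h.contDiffOn
  have h0 : (0 : ℝ) ∈ Icc (-1 : ℝ) 1 := by norm_num
  have hIoo : ∀ᶠ s : ℝ in 𝓝 0, s ∈ Ioo (-1 : ℝ) 1 := Ioo_mem_nhds (by norm_num) (by norm_num)
  have hIcc : ∀ s ∈ Ioo (-1 : ℝ) 1, Icc (-1 : ℝ) 1 ∈ 𝓝 s := fun s hs => Icc_mem_nhds hs.1 hs.2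
  set x₁ : ℝ → Eu n := fun s =>
    -ContinuousLinearMap.adjoint (mixedHessian c U V (x s) (y 0)).inverse ζ with hx₁
  set y₁ : ℝ → Eu n := fun t => -(mixedHessian c U V (x 0) (y t)).inverse w with hy₁
  have hxd : ∀ s ∈ Ioo (-1 : ℝ) 1, HasDerivAt x (x₁ s) s := fun s hs =>
    (hx s (Ioo_subset_Icc_self hs)).2.hasDerivAt (hIcc s hs)
  have hyd : ∀ t ∈ Ioo (-1 : ℝ) 1, HasDerivAt y (y₁ t) t := fun t ht =>
    (hy t (Ioo_subset_Icc_self ht)).2.hasDerivAt (hIcc t ht)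
  have hz0 : K ∈ 𝓝 (x 0, y 0) := h.prod_mem_nhds ⟨hx0, hy0⟩
  have hz0K : (x 0, y 0) ∈ K := mem_of_mem_nhds hz0
  have h0' : (0 : ℝ) ∈ Ioo (-1 : ℝ) 1 := by norm_num
  have hxU : ∀ᶠ s in 𝓝 (0 : ℝ), x s ∈ U :=
    (hxd 0 h0').continuousAt.eventually (h.isOpen_fst.mem_nhds hx0)
  have hyV : ∀ᶠ t in 𝓝 (0 : ℝ), y t ∈ V :=
    (hyd 0 h0').continuousAt.eventually (h.isOpen_snd.mem_nhds hy0)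
  -- curves in the product
  have hγx : ∀ s ∈ Ioo (-1 : ℝ) 1, HasDerivAt (fun s => (x s, y 0)) (x₁ s, (0 : Eu n)) s :=
    fun s hs => (hxd s hs).prodMk (hasDerivAt_const s _)
  have hγy : ∀ a : Eu n, ∀ t ∈ Ioo (-1 : ℝ) 1,
      HasDerivAt (fun t => (a, y t)) ((0 : Eu n), y₁ t) t :=
    fun a t ht => (hasDerivAt_const t _).prodMk (hyd t ht)
  -- accelerations
  obtain ⟨σ, hσ⟩ : ∃ σ, HasDerivAt x₁ σ 0 := by
    have h1 := hasDerivAt_comp_of_contDiffOn two_ne_zero h.contDiffOn_inverse (hγx 0 h0') hz0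
    exact ⟨_, (differentiableAt_adjoint_apply h1.differentiableAt ζ).neg.hasDerivAt⟩
  obtain ⟨α, hα⟩ : ∃ α, HasDerivAt y₁ α 0 := by
    have h1 := hasDerivAt_comp_of_contDiffOn two_ne_zero h.contDiffOn_inverse (hγy (x 0) 0 h0') hz0
    exact ⟨_, (h1.clm_apply (hasDerivAt_const 0 w)).neg⟩
  have hσ' : HasDerivAt (fun s => (x₁ s, (0 : Eu n))) (σ, (0 : Eu n)) 0 :=
    hσ.prodMk (hasDerivAt_const 0 _)
  have hα' : HasDerivAt (fun t => ((0 : Eu n), y₁ t)) ((0 : Eu n), α) 0 :=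
    (hasDerivAt_const 0 _).prodMk hα
  have hx₁0 : x₁ 0 = ξ := hξ
  have hxK : ∀ᶠ s in 𝓝 (0 : ℝ), K ∈ 𝓝 (x s, y 0) :=
    hxU.mono fun s hs => h.prod_mem_nhds ⟨hs, hy0⟩
  refine ⟨?_, ?_⟩
  · have h1 : (fun s : ℝ => deriv (fun t : ℝ => c (x s) (y t)) 0) =ᶠ[𝓝 0]
        fun s => dirDeriv K ((0 : Eu n), y₁ 0) C (x s, y 0) := by
      filter_upwards [hxK] with s hs
      exact (hasDerivAt_comp_of_contDiffOn four_ne_zero hCd (hγy (x s) 0 h0') hs).deriv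
    have h2 := hasDerivAt_comp_of_contDiffOn (k := 2) two_ne_zero
      (contDiffOn_dirDeriv hKu hCd (by norm_num) ((0 : Eu n), y₁ 0)) (hγx 0 h0') hz0
    rw [h1.deriv_eq, h2.deriv]
    have h3 := dirDeriv_dirDeriv hKu (hCd.of_le (by norm_num)) hz0K (x₁ 0, (0 : Eu n))
      ((0 : Eu n), y₁ 0)
    rw [dirDeriv] at h3
    rw [h3, h.isSymm (hCd.of_le (by norm_num)) hz0K, ← h.inner_mixedHessian hz0K, hx₁0]
    simp only [hy₁, map_neg, inner_neg_left]
    rw [h.mixedHessian_inverse_apply hz0K.1 hz0K.2]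
  · set v : Eu n × Eu n := (0, y₁ 0) with hv
    set a : Eu n × Eu n := (0, α) with ha
    have h1 : (fun s : ℝ => iteratedDeriv 2 (fun t : ℝ => c (x s) (y t)) 0) =ᶠ[𝓝 0]
        fun s => secondOrder K v a C (x s, y 0) := by
      filter_upwards [hxK] with s hs
      have hC2 : ContDiffOn ℝ 2 C K := hCd.of_le (by norm_num)
      exact iteratedDeriv_two_comp (γ := fun t => (x s, y t)) (γ₁ := fun t => ((0 : Eu n), y₁ t))
        (t := 0) hKu hC2 (hIoo.mono fun t ht => hγy (x s) t ht) hα' hs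
    have hso : ContDiffOn ℝ 2 (secondOrder K v a C) K :=
      contDiffOn_secondOrder hKu hCd (m := 2) (by norm_num) v a
    have h1' := iteratedDeriv_two_comp (γ := fun s => (x s, y 0))
      (γ₁ := fun s => (x₁ s, (0 : Eu n))) hKu hso (hIoo.mono fun s hs => hγx s hs) hσ' hz0
    rw [h1.iteratedDeriv_eq, h1', hx₁0]
    set u : Eu n × Eu n := (ξ, 0) with hu
    have hC3 : ContDiffOn ℝ 3 (dirDeriv K u C) K := contDiffOn_dirDeriv hKu hCd (by norm_num) u
    have hC2 : ContDiffOn ℝ 2 (dirDeriv K u (dirDeriv K u C)) K :=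
      contDiffOn_dirDeriv hKu hC3 (by norm_num) u
    have hCσ : ContDiffOn ℝ 2 (dirDeriv K (σ, 0) C) K :=
      contDiffOn_dirDeriv hKu hCd (by norm_num) _
    -- the derivatives in the two factors are exchanged
    have h2 : secondOrder K u (σ, 0) (secondOrder K v a C) (x 0, y 0) =
        secondOrder K v a (dirDeriv K u (dirDeriv K u C)) (x 0, y 0) +
          secondOrder K v a (dirDeriv K (σ, 0) C) (x 0, y 0) := by
      rw [secondOrder, dirDeriv_secondOrder hKu hKc (hCd.of_le (by norm_num)) hz0K,
        dirDeriv_congr (fun z hz => dirDeriv_secondOrder hKu hKc (hCd.of_le (by norm_num)) hz u v a)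
          hz0K, dirDeriv_secondOrder hKu hKc hC3 hz0K]
    have hγyK : ∀ᶠ t in 𝓝 (0 : ℝ), K ∈ 𝓝 (x 0, y t) :=
      hyV.mono fun t ht => h.prod_mem_nhds ⟨hx0, ht⟩
    have hx0c : x 0 ∈ closure U := subset_closure hx0
    -- the acceleration of `x` does not contribute, as `D_x c(x 0, y t)` is affine in `t`
    have h3 : secondOrder K v a (dirDeriv K (σ, 0) C) (x 0, y 0) = 0 := by
      have e1 := hasDerivAt_fderivWithin_comp hKu hCσ (hγy (x 0) 0 h0') hα' hz0
      have e2 : (fun t => fderivWithin ℝ (dirDeriv K (σ, 0) C) K (x 0, y t) ((0 : Eu n), y₁ t))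
          =ᶠ[𝓝 0] fun _ => -⟪w, σ⟫ := by
        filter_upwards [hγyK, hIoo] with t ht ht'
        have e3 := hasDerivAt_comp_of_contDiffOn two_ne_zero hCσ (hγy (x 0) t ht') ht
        have e4 : (fun t => dirDeriv K (σ, 0) C (x 0, y t)) =ᶠ[𝓝 t]
            fun t => -(⟪p, σ⟫ + t * ⟪w, σ⟫) := by
          filter_upwards [Ioo_mem_nhds ht'.1 ht'.2] with t' ht''
          have ht3 := Ioo_subset_Icc_self ht''
          have e5 := h.dirDeriv_cost_fst (z := (x 0, y t')) ⟨hx0c, (hy t' ht3).1⟩ σ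
          rw [← neg_neg (gradFst c U (x 0, y t').1 (x 0, y t').2), hyA t' ht3] at e5
          rw [hC, e5, inner_neg_left, inner_add_left, real_inner_smul_left]
        have e6 : HasDerivAt (fun t : ℝ => -(⟪p, σ⟫ + t * ⟪w, σ⟫)) (-⟪w, σ⟫) t := by
          have e7 := (((hasDerivAt_id t).mul_const ⟪w, σ⟫).const_add ⟪p, σ⟫).neg
          rw [one_mul] at e7
          exact e7
        exact (e3.congr_of_eventuallyEq e4.symm).unique e6
      exact (e1.congr_of_eventuallyEq e2.symm).unique (hasDerivAt_const 0 _)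
    have h4 : secondOrder K v a (dirDeriv K u (dirDeriv K u C)) (x 0, y 0) =
        segHessian c U V (x 0, y 0) w w u u := by
      have e1 := hasDerivAt_fderivWithin_comp hKu hC2 (hγy (x 0) 0 h0') hα' hz0
      have hyV' : ∀ t ∈ Icc (-1 : ℝ) 1, y t ∈ closure V := fun t ht => (hy t ht).1
      have e2 : (fun t => fderivWithin ℝ (dirDeriv K u (dirDeriv K u C)) K (x 0, y t)
          ((0 : Eu n), y₁ t)) =ᶠ[𝓝 0]
          fun t => segDeriv c U V (costHessian c U V) (x 0, y t) w u u := by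
        filter_upwards [hγyK, hIoo] with t ht ht'
        have e3 := hasDerivAt_comp_of_contDiffOn two_ne_zero hC2 (hγy (x 0) t ht') ht
        have e4 := ((hasDerivWithinAt_segDeriv two_ne_zero h.contDiffOn_costHessian hx0c hyV'
          (Ioo_subset_Icc_self ht') (hy t (Ioo_subset_Icc_self ht')).2).hasDerivAt (hIcc t ht'))
        have e5 := (e4.clm_apply (hasDerivAt_const t u)).clm_apply (hasDerivAt_const t u)
        simp only [map_zero, add_zero] at e5
        refine e3.unique (e5.congr_of_eventuallyEq ?_)
        filter_upwards [Ioo_mem_nhds ht'.1 ht'.2] with t' ht''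
        exact dirDeriv_dirDeriv hKu (hCd.of_le (by norm_num))
          ⟨hx0c, (hy t' (Ioo_subset_Icc_self ht'')).1⟩ u u
      have e6 := ((hasDerivWithinAt_segDeriv one_ne_zero h.contDiffOn_segDeriv_costHessian hx0c hyV'
          h0 (hy 0 h0).2).hasDerivAt (hIcc 0 h0'))
      have e7 := (((e6.clm_apply (hasDerivAt_const 0 w)).clm_apply
        (hasDerivAt_const 0 u)).clm_apply (hasDerivAt_const 0 u))
      simp only [map_zero, add_zero] at e7
      exact (e1.congr_of_eventuallyEq e2.symm).unique e7
    rw [h2, h3, h4, add_zero]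

/-- Condition (B3) in tensorial form, extended to the boundary by continuity. -/
theorem segHessian_nonpos (hB3 : CondB3 c U V) {z : Eu n × Eu n}
    (hz : z ∈ closure U ×ˢ closure V) {ξ η : Eu n} (hξη : ⟪η, ξ⟫ = 0) :
    segHessian c U V z η η (ξ, 0) (ξ, 0) ≤ 0 := by
  have hint : ∀ z ∈ U ×ˢ V, segHessian c U V z η η (ξ, 0) (ξ, 0) ≤ 0 := by
    rintro ⟨x₀, y₀⟩ ⟨hx₀, hy₀⟩
    have hx₀c : x₀ ∈ closure U := subset_closure hx₀
    have hy₀c : y₀ ∈ closure V := subset_closure hy₀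
    obtain ⟨κ, hκ, hκ'⟩ := exists_smul_forall_mem (h.isOpen_codomFrom hx₀c)
      (mem_image_of_mem (fun y => -gradFst c U x₀ y) hy₀) η
    obtain ⟨μ, hμ, hμ'⟩ := exists_smul_forall_mem (h.isOpen_domFrom hy₀c)
      (mem_image_of_mem (fun x => -gradSnd c V x y₀) hx₀)
      (-ContinuousLinearMap.adjoint (mixedHessian c U V x₀ y₀) ξ)
    obtain ⟨y, hy⟩ := h.exists_curve_snd hx₀c (uniqueDiffOn_Icc (by norm_num : (-1 : ℝ) < 1))
      (fun t ht => image_mono subset_closure (hκ' t ht))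
    obtain ⟨x, hx⟩ := h.exists_curve_fst hy₀c (uniqueDiffOn_Icc (by norm_num : (-1 : ℝ) < 1))
      (fun t ht => image_mono subset_closure (hμ' t ht))
    have h0 : (0 : ℝ) ∈ Icc (-1 : ℝ) 1 := by norm_num
    have hy0 : y 0 = y₀ := h.injOn_gradFst hx₀c (hy 0 h0).1 hy₀c (by simpa using (hy 0 h0).2.1)
    have hx0 : x 0 = x₀ := h.injOn_gradSnd hy₀c (hx 0 h0).1 hx₀c (by simpa using (hx 0 h0).2.1)
    obtain ⟨e1, e2⟩ := h.segHessian_eq_iteratedDeriv (x := x) (y := y)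
      (ζ := μ • -ContinuousLinearMap.adjoint (mixedHessian c U V x₀ y₀) ξ) (w := κ • η) (ξ := μ • ξ)
      (by rwa [hx0]) (by rwa [hy0]) (fun s hs => ⟨(hx s hs).1, by rw [hy0]; exact (hx s hs).2.2⟩)
      (fun t ht => ⟨(hy t ht).1, by rw [hx0]; exact (hy t ht).2.2⟩)
      ⟨-gradFst c U x₀ y₀, fun t ht => by rw [hx0]; exact (hy t ht).2.1⟩
      (by rw [hx0, hy0]; simp [h.adjoint_inverse_apply hx₀c hy₀c])
    have h1 := hB3 x y (fun t ht => (hx t ht).1) (fun t ht => (hy t ht).1)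
      ⟨gradSnd c V x₀ y₀, -(μ • -ContinuousLinearMap.adjoint (mixedHessian c U V x₀ y₀) ξ),
        fun t ht => by
          have := congrArg Neg.neg (hx t ht).2.1
          rw [neg_neg] at this
          rw [hy0, this]; module⟩
      ⟨gradFst c U x₀ y₀, -(κ • η), fun t ht => by
          have := congrArg Neg.neg (hy t ht).2.1
          rw [neg_neg] at this
          rw [hx0, this]; module⟩
      (by rw [e1, real_inner_smul_left, real_inner_smul_right, hξη]; simp)
    rw [e2, hx0, hy0] at h1
    have hsm : ((μ • ξ, 0) : Eu n × Eu n) = μ • (ξ, 0) := by simp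
    rw [hsm] at h1
    simp only [map_smul, smul_apply, smul_eq_mul] at h1
    by_contra! hpos
    have : 0 < κ * (κ * (μ * (μ * segHessian c U V (x₀, y₀) η η (ξ, 0) (ξ, 0)))) := by positivity
    linarith
  have hcont : ContinuousOn (fun z => segHessian c U V z η η (ξ, 0) (ξ, 0))
      (closure U ×ˢ closure V) :=
    (((h.continuousOn_segHessian.clm_apply continuousOn_const).clm_apply
      continuousOn_const).clm_apply continuousOn_const).clm_apply continuousOn_const
  have hzc : z ∈ closure (U ×ˢ V) := by rwa [closure_prod_eq]
  have hne : (𝓝[U ×ˢ V] z).NeBot := mem_closure_iff_nhdsWithin_neBot.1 hzc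
  exact le_of_tendsto ((hcont z hz).mono (prod_mono subset_closure subset_closure))
    (by filter_upwards [self_mem_nhdsWithin] with y hy using hint y hy)

end RegularCost

end Curvature

/-! ### The modified cost in cost exponential coordinates -/

section ModifiedCost

variable {n : ℕ} {c : Eu n → Eu n → ℝ} {U V : Set (Eu n)} {ybar : Eu n}

namespace RegularCost

variable (h : RegularCost c U V)
include h

theorem costExp_spec (hyb : ybar ∈ closure V) {q : Eu n}
    (hq : q ∈ closure (domFrom c U V ybar)) :
    costExp c U V ybar q ∈ closure U ∧ -gradSnd c V (costExp c U V ybar q) ybar = q := by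
  rw [← h.image_neg_gradSnd hyb] at hq
  exact ⟨Function.invFunOn_mem hq, Function.invFunOn_eq hq⟩

theorem costExp_mem (hyb : ybar ∈ closure V) {q : Eu n}
    (hq : q ∈ closure (domFrom c U V ybar)) : costExp c U V ybar q ∈ closure U :=
  (h.costExp_spec hyb hq).1

theorem costExp_mem_open (hyb : ybar ∈ closure V) {q : Eu n} (hq : q ∈ domFrom c U V ybar) :
    costExp c U V ybar q ∈ U := by
  have h1 := h.costExp_spec hyb (subset_closure hq)
  exact h.mem_fst_of_mem_domFrom h1.1 hyb (by rwa [h1.2])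

theorem hasFDerivWithinAt_costExp (hyb : ybar ∈ closure V) {q : Eu n}
    (hq : q ∈ closure (domFrom c U V ybar)) :
    HasFDerivWithinAt (costExp c U V ybar)
      (-ContinuousLinearMap.adjoint (mixedHessian c U V (costExp c U V ybar q) ybar).inverse)
      (closure (domFrom c U V ybar)) q := by
  obtain ⟨-, g, hg, hgf⟩ := h.b1.1 ybar hyb
  rw [h.image_neg_gradSnd hyb] at hg
  have heq : ∀ p ∈ closure (domFrom c U V ybar), costExp c U V ybar p = g p := by
    intro p hp
    have h1 := h.costExp_spec hyb hp
    have h2 := hgf h1.1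
    simp only [h1.2] at h2
    exact h2.symm
  have hd := ((hg.differentiableOn one_ne_zero) q hq).hasFDerivWithinAt.congr heq (heq q hq)
  have h1 := h.costExp_spec hyb hq
  have h2 := (h.hasFDerivWithinAt_gradSnd (z := (costExp c U V ybar q, ybar))
    ⟨h1.1, hyb⟩).neg.comp q hd (fun p hp => h.costExp_mem hyb hp)
  have h3 := (hasFDerivWithinAt_id (𝕜 := ℝ) q (closure (domFrom c U V ybar))).congr
    (f₁ := (-fun x => gradSnd c V x ybar) ∘ costExp c U V ybar)
    (fun p hp => (h.costExp_spec hyb hp).2) h1.2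
  have h4 := (h.uniqueDiffOn_domFrom hyb q hq).eq h2 h3
  refine hd.congr_fderiv ?_
  ext1 k
  have h5 := congrArg (fun T : Eu n →L[ℝ] Eu n => T k) h4
  simp only [ContinuousLinearMap.comp_apply, neg_apply, ContinuousLinearMap.id_apply] at h5
  rw [neg_apply]
  nth_rewrite 2 [← h5]
  rw [map_neg, h.adjoint_inverse_apply h1.1 hyb, neg_neg]

theorem continuousOn_costExp (hyb : ybar ∈ closure V) :
    ContinuousOn (costExp c U V ybar) (closure (domFrom c U V ybar)) :=
  fun _ hq => (h.hasFDerivWithinAt_costExp hyb hq).continuousWithinAt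

theorem continuousOn_modCost (hyb : ybar ∈ closure V) :
    ContinuousOn (fun z : Eu n × Eu n => modCost c U V ybar z.1 z.2)
      (closure (domFrom c U V ybar) ×ˢ closure V) := by
  have hX : ContinuousOn (fun z : Eu n × Eu n => costExp c U V ybar z.1)
      (closure (domFrom c U V ybar) ×ˢ closure V) :=
    (h.continuousOn_costExp hyb).comp continuousOn_fst (fun z hz => hz.1)
  have h1 := h.contDiffOn.continuousOn.comp (hX.prodMk continuousOn_snd)
    (fun z hz => ⟨h.costExp_mem hyb hz.1, hz.2⟩)
  have h2 := h.contDiffOn.continuousOn.comp (hX.prodMk (continuousOn_const (c := ybar)))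
    (fun z hz => ⟨h.costExp_mem hyb hz.1, hyb⟩)
  exact h1.sub h2

theorem hasGradientWithinAt_cost {x y : Eu n} (hx : x ∈ closure U) (hy : y ∈ closure V) :
    HasGradientWithinAt (fun x => c x y) (gradFst c U x y) (closure U) x := by
  have hd := (h.contDiffOn.differentiableOn (by norm_num)) (x, y) ⟨hx, hy⟩
  exact (hasFDerivWithinAt_comp_mk_right (x := x) (y := y) hy
    hd).differentiableWithinAt.hasGradientWithinAt

theorem hasGradientWithinAt_modCost (hyb : ybar ∈ closure V) {q y : Eu n}
    (hq : q ∈ closure (domFrom c U V ybar)) (hy : y ∈ closure V) :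
    HasGradientWithinAt (fun q => modCost c U V ybar q y)
      (-(mixedHessian c U V (costExp c U V ybar q) ybar).inverse
        (gradFst c U (costExp c U V ybar q) y - gradFst c U (costExp c U V ybar q) ybar))
      (closure (domFrom c U V ybar)) q := by
  have hx := h.costExp_mem hyb hq
  have h1 := (h.hasGradientWithinAt_cost hx hy).hasFDerivWithinAt.sub
    (h.hasGradientWithinAt_cost hx hyb).hasFDerivWithinAt
  have h2 := h1.comp q (h.hasFDerivWithinAt_costExp hyb hq) (fun p hp => h.costExp_mem hyb hp)
  refine hasGradientWithinAt_iff_hasFDerivWithinAt.2 (HasFDerivWithinAt.congr_fderiv h2 ?_)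
  ext1 k
  simp only [ContinuousLinearMap.comp_apply, sub_apply, neg_apply,
    InnerProductSpace.toDual_apply_apply, inner_neg_left, inner_neg_right]
  rw [ContinuousLinearMap.adjoint_inner_right, ContinuousLinearMap.adjoint_inner_right, map_sub,
    inner_sub_left]
  ring

/-- Differentiating `⟪D²_{xy}c(l), k⟫ = D²c((0, l), (k, 0))` in `x` and exchanging derivatives. -/
theorem inner_mixedThird {z : Eu n × Eu n} (hz : z ∈ closure U ×ˢ closure V) (k' l k : Eu n) :
    ⟪mixedThird c U V z.1 z.2 k' l, k⟫ =
      fderivWithin ℝ (costHessian c U V) (closure U ×ˢ closure V) z (0, l) (k', 0) (k, 0) := by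
  set K := closure U ×ˢ closure V with hK
  set C : Eu n × Eu n → ℝ := fun z => c z.1 z.2 with hC
  have hKu : UniqueDiffOn ℝ K := h.uniqueDiffOn
  have hCd : ContDiffOn ℝ 4 C K := h.contDiffOn
  have hC2 : ContDiffOn ℝ 2 C K := hCd.of_le (by norm_num)
  have hk3 : ContDiffOn ℝ 3 (dirDeriv K (k, 0) C) K := contDiffOn_dirDeriv hKu hCd (by norm_num) _
  have hk2 : ContDiffOn ℝ 2 (dirDeriv K (k, 0) C) K := hk3.of_le (by norm_num)
  have hl : ContDiffOn ℝ 2 (dirDeriv K (0, l) (dirDeriv K (k, 0) C)) K :=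
    contDiffOn_dirDeriv hKu hk3 (by norm_num) _
  have e1 := ((h.hasFDerivWithinAt_mixedHessian hz).clm_apply
    (hasFDerivWithinAt_const l z.1 (closure U))).inner ℝ (hasFDerivWithinAt_const k z.1 (closure U))
  have e2 := hasFDerivWithinAt_comp_mk_right (x := z.1) (y := z.2) hz.2
    (hl.differentiableOn two_ne_zero z hz)
  have e3 : ∀ x ∈ closure U, ⟪mixedHessian c U V x z.2 l, k⟫ =
      dirDeriv K (0, l) (dirDeriv K (k, 0) C) (x, z.2) := fun x hx => by
    rw [dirDeriv_dirDeriv hKu hC2 (z := (x, z.2)) ⟨hx, hz.2⟩]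
    exact h.inner_mixedHessian (z := (x, z.2)) ⟨hx, hz.2⟩ l k
  have e4 := (h.uniqueDiffOn_fst z.1 hz.1).eq e1 (e2.congr e3 (e3 z.1 hz.1))
  have e5 := congrArg (fun T : Eu n →L[ℝ] ℝ => T k') e4
  have e6 : ⟪mixedThird c U V z.1 z.2 k' l, k⟫ =
      dirDeriv K (k', 0) (dirDeriv K (0, l) (dirDeriv K (k, 0) C)) z := by
    simpa [fderivInnerCLM_apply, dirDeriv] using e5
  rw [e6, dirDeriv_comm hKu h.subset_closure_interior hk2 hz,
    dirDeriv_congr (fun z hz => dirDeriv_dirDeriv hKu hC2 hz _ _) hz]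
  have e7 := ((h.contDiffOn_costHessian.differentiableOn two_ne_zero z
    hz).hasFDerivWithinAt.clm_apply (hasFDerivWithinAt_const ((k', 0) : Eu n × Eu n) z
      K)).clm_apply (hasFDerivWithinAt_const ((k, 0) : Eu n × Eu n) z K)
  have e8 : fderivWithin ℝ (fun z => costHessian c U V z (k', 0) (k, 0)) K z = _ :=
    e7.fderivWithin (hKu z hz)
  have e9 : dirDeriv K (0, l) (fun z => costHessian c U V z (k', 0) (k, 0)) z = _ :=
    congrArg (fun T : Eu n × Eu n →L[ℝ] ℝ => T (0, l)) e8
  refine Eq.trans e9 ?_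
  simp
  rfl

end RegularCost

end ModifiedCost

/-! ### Quasiconvexity of the modified cost -/

section Quasiconvexity

theorem neg_mul_le_sub_of_neg_le_deriv {g g' : ℝ → ℝ} {m : ℝ}
    (hg : ∀ s ∈ Icc (0 : ℝ) 1, HasDerivWithinAt g (g' s) (Icc 0 1) s)
    (hm : ∀ s ∈ Icc (0 : ℝ) 1, -m ≤ g' s) {s : ℝ} (hs : s ∈ Icc (0 : ℝ) 1) :
    -m * s ≤ g s - g 0 := by
  have hd : ∀ s ∈ Icc (0 : ℝ) 1,
      HasDerivWithinAt (fun s => g s + m * s) (g' s + m) (Icc 0 1) s := by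
    intro s hs
    have := (hg s hs).add ((hasDerivWithinAt_id s (Icc 0 1)).const_mul m)
    rwa [mul_one] at this
  have hmono : MonotoneOn (fun s => g s + m * s) (Icc 0 1) := by
    refine monotoneOn_of_hasDerivWithinAt_nonneg (f' := fun s => g' s + m) (convex_Icc 0 1)
      (fun s hs => (hd s hs).continuousWithinAt)
      (fun s hs => (hd s (interior_subset hs)).mono interior_subset)
      (fun s hs => by linarith [hm s (interior_subset hs)])
  have h1 := hmono ⟨le_rfl, zero_le_one⟩ hs hs.1
  simp only [mul_zero, add_zero] at h1
  linarith

/-- If the initial slope vanishes and `g'' ≥ -m`, then `g` decreases by at most `m` on the unit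
interval. -/
theorem neg_le_sub_of_neg_le_deriv_deriv {g g' g'' : ℝ → ℝ} {m : ℝ} (hm0 : 0 ≤ m)
    (hg : ∀ s ∈ Icc (0 : ℝ) 1, HasDerivWithinAt g (g' s) (Icc 0 1) s)
    (hg' : ∀ s ∈ Icc (0 : ℝ) 1, HasDerivWithinAt g' (g'' s) (Icc 0 1) s)
    (hm : ∀ s ∈ Icc (0 : ℝ) 1, -m ≤ g'' s) (h0 : g' 0 = 0) : -m ≤ g 1 - g 0 := by
  have h1 : ∀ s ∈ Icc (0 : ℝ) 1, -m ≤ g' s := fun s hs => by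
    have := neg_mul_le_sub_of_neg_le_deriv hg' hm hs
    rw [h0, sub_zero] at this
    nlinarith [hs.1, hs.2]
  simpa using neg_mul_le_sub_of_neg_le_deriv hg h1 (s := 1) ⟨zero_le_one, le_rfl⟩

variable {n : ℕ} {c : Eu n → Eu n → ℝ} {U V : Set (Eu n)} {ybar : Eu n}

/-- A quadratic form in `ξ` which is nonpositive for `ξ ⊥ η` is bounded above by a multiple of
`|⟪η, ξ⟫|`, by splitting off the component of `ξ` along `η`. -/
theorem apply_le_of_nonpos_of_inner_eq_zero
    (B : Eu n →L[ℝ] Eu n →L[ℝ] Eu n × Eu n →L[ℝ] Eu n × Eu n →L[ℝ] ℝ) (η : Eu n)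
    (hB : ∀ ξ : Eu n, ⟪η, ξ⟫ = 0 → B η η (ξ, 0) (ξ, 0) ≤ 0) (ξ : Eu n) :
    B η η (ξ, 0) (ξ, 0) ≤ 2 * ‖B‖ * ‖η‖ * ‖ξ‖ * |⟪η, ξ⟫| := by
  rcases eq_or_ne η 0 with rfl | hη
  · simp
  have hηn : 0 < ‖η‖ := norm_pos_iff.2 hη
  set w := (⟪η, ξ⟫ / ‖η‖ ^ 2) • η with hw
  set ξ₀ := ξ - w with hξ₀
  have hηξ₀ : ⟪η, ξ₀⟫ = 0 := by
    rw [hξ₀, hw, inner_sub_right, inner_smul_right, real_inner_self_eq_norm_sq]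
    field_simp
    ring
  have hwn : ‖w‖ * ‖η‖ = |⟪η, ξ⟫| := by
    rw [hw, norm_smul, norm_div, norm_pow, norm_norm, Real.norm_eq_abs]
    field_simp
  have hwξ : ‖w‖ ≤ ‖ξ‖ := by
    have h1 := abs_real_inner_le_norm η ξ
    rw [← hwn, mul_comm] at h1
    exact le_of_mul_le_mul_left h1 hηn
  have hξ₀n : ‖ξ₀‖ ≤ ‖ξ‖ := by
    have h1 : ‖ξ‖ ^ 2 = ‖ξ₀‖ ^ 2 + ‖w‖ ^ 2 := by
      have h2 : ξ = ξ₀ + w := by rw [hξ₀]; abel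
      have h3 : ⟪ξ₀, w⟫ = 0 := by rw [hw, inner_smul_right, real_inner_comm η ξ₀, hηξ₀, mul_zero]
      nth_rewrite 1 [h2]
      rw [norm_add_sq_real, h3]
      ring
    exact abs_le_of_sq_le_sq' (by nlinarith [sq_nonneg ‖w‖]) (norm_nonneg _) |>.2
  have hbd : ∀ a b : Eu n, |B η η (a, 0) (b, 0)| ≤ ‖B‖ * ‖η‖ * ‖η‖ * ‖a‖ * ‖b‖ := by
    intro a b
    have ha : ‖((a, 0) : Eu n × Eu n)‖ = ‖a‖ := by simp [Prod.norm_def]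
    have hb : ‖((b, 0) : Eu n × Eu n)‖ = ‖b‖ := by simp [Prod.norm_def]
    calc |B η η (a, 0) (b, 0)| ≤ ‖B η η (a, 0)‖ * ‖b‖ := by
          rw [← hb]; exact (B η η (a, 0)).le_opNorm _
      _ ≤ ‖B η η‖ * ‖a‖ * ‖b‖ := by
          rw [← ha]; gcongr; exact (B η η).le_opNorm _
      _ ≤ ‖B‖ * ‖η‖ * ‖η‖ * ‖a‖ * ‖b‖ := by
          gcongr; exact B.le_opNorm₂ _ _
  have hsplit : B η η (ξ, 0) (ξ, 0) =
      B η η (ξ₀, 0) (ξ₀, 0) + B η η (ξ₀, 0) (w, 0) + B η η (w, 0) (ξ, 0) := by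
    have h2 : ((ξ, 0) : Eu n × Eu n) = (ξ₀, 0) + (w, 0) := by
      rw [Prod.mk_add_mk, hξ₀]; simp
    rw [h2]
    simp only [map_add, add_apply]
    ring
  have e1 := hB ξ₀ hηξ₀
  have e2 := (le_abs_self _).trans (hbd ξ₀ w)
  have e3 := (le_abs_self _).trans (hbd w ξ)
  have e4 : ‖B‖ * ‖η‖ * ‖η‖ * ‖ξ₀‖ * ‖w‖ ≤ ‖B‖ * ‖η‖ * ‖η‖ * ‖ξ‖ * ‖w‖ := by gcongr
  have e5 : ‖B‖ * ‖η‖ * ‖η‖ * ‖ξ‖ * ‖w‖ = ‖B‖ * ‖η‖ * ‖ξ‖ * |⟪η, ξ⟫| := by rw [← hwn]; ring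
  have e6 : ‖B‖ * ‖η‖ * ‖η‖ * ‖w‖ * ‖ξ‖ = ‖B‖ * ‖η‖ * ‖ξ‖ * |⟪η, ξ⟫| := by rw [← hwn]; ring
  rw [hsplit]
  linarith

namespace RegularCost

variable (h : RegularCost c U V)
include h

theorem exists_curve_snd_Icc {x y₀ y₁ : Eu n} (hx : x ∈ closure U) (hy₀ : y₀ ∈ closure V)
    (hy₁ : y₁ ∈ closure V) :
    ∃ γ : ℝ → Eu n, γ 0 = y₀ ∧ γ 1 = y₁ ∧ ∀ s ∈ Icc (0 : ℝ) 1, γ s ∈ closure V ∧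
      HasDerivWithinAt γ (-(mixedHessian c U V x (γ s)).inverse
        (gradFst c U x y₀ - gradFst c U x y₁)) (Icc 0 1) s := by
  have hp : ∀ s ∈ Icc (0 : ℝ) 1, -gradFst c U x y₀ + s • (gradFst c U x y₀ - gradFst c U x y₁) ∈
      (fun y => -gradFst c U x y) '' closure V := by
    intro s hs
    have h0 := mem_image_of_mem (fun y => -gradFst c U x y) hy₀
    have h1 := mem_image_of_mem (fun y => -gradFst c U x y) hy₁
    rw [h.image_neg_gradFst hx] at h0 h1 ⊢
    have := (h.b2.2 x hx).closure.add_smul_sub_mem h0 h1 hs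
    rwa [neg_sub_neg] at this
  obtain ⟨γ, hγ⟩ := h.exists_curve_snd hx (uniqueDiffOn_Icc zero_lt_one) hp
  have h0 := hγ 0 ⟨le_rfl, zero_le_one⟩
  have h1 := hγ 1 ⟨zero_le_one, le_rfl⟩
  refine ⟨γ, h.injOn_gradFst hx h0.1 hy₀ ?_, h.injOn_gradFst hx h1.1 hy₁ ?_,
    fun s hs => ⟨(hγ s hs).1, (hγ s hs).2.2⟩⟩
  · simpa using h0.2.1
  · have := h1.2.1
    simp only [one_smul] at this
    simp only [this]
    abel

/-- The second derivative of `-c̃(·, y)` along a segment in cost exponential coordinates,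
`F₂ = -D²_{xx}c(x, y)(ẋ, ẋ) + D²_{xx}c(x, ȳ)(ẋ, ẋ) + ⟪η, ẍ⟫`, is bounded below by a multiple of the
size of the first derivative `⟪η, ẋ⟫`: interpolating between `ȳ` and `y` by a segment with respect
to `x`, the second derivative starts from `0` with vanishing slope and is convex up to an error
controlled by `⟪η, ẋ⟫`, by the curvature condition. -/
theorem second_variation_ge (hB3 : CondB3 c U V) (hyb : ybar ∈ closure V) {S : ℝ}
    (hS : ∀ z ∈ closure U ×ˢ closure V, ‖segHessian c U V z‖ ≤ S) {x y : Eu n}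
    (hx : x ∈ closure U) (hy : y ∈ closure V) {ξ α : Eu n}
    (hacc : ∀ l : Eu n, ⟪mixedHessian c U V x ybar l, α⟫ + ⟪mixedThird c U V x ybar ξ l, ξ⟫ = 0) :
    -(2 * S * ‖gradFst c U x ybar - gradFst c U x y‖ * ‖ξ‖ *
        |⟪gradFst c U x ybar - gradFst c U x y, ξ⟫|) ≤
      -costHessian c U V (x, y) (ξ, 0) (ξ, 0) + costHessian c U V (x, ybar) (ξ, 0) (ξ, 0) +
        ⟪gradFst c U x ybar - gradFst c U x y, α⟫ := by
  set η := gradFst c U x ybar - gradFst c U x y with hη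
  obtain ⟨γ, hγ0, hγ1, hγ⟩ := h.exists_curve_snd_Icc hx hyb hy
  have hγV : ∀ s ∈ Icc (0 : ℝ) 1, γ s ∈ closure V := fun s hs => (hγ s hs).1
  set u : Eu n × Eu n := (ξ, 0) with hu
  have hS0 : 0 ≤ S := (norm_nonneg (segHessian c U V (x, y))).trans (hS (x, y) ⟨hx, hy⟩)
  have key := neg_le_sub_of_neg_le_deriv_deriv
    (g := fun s => -costHessian c U V (x, γ s) u u + s * ⟪η, α⟫)
    (g' := fun s => -segDeriv c U V (costHessian c U V) (x, γ s) η u u + ⟪η, α⟫)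
    (g'' := fun s => -segHessian c U V (x, γ s) η η u u)
    (m := 2 * S * ‖η‖ * ‖ξ‖ * |⟪η, ξ⟫|) (by positivity) ?_ ?_ ?_ ?_
  · simp only [hγ0, hγ1, one_mul, zero_mul, add_zero] at key
    linarith
  · intro s hs
    have e1 := hasDerivWithinAt_segDeriv two_ne_zero h.contDiffOn_costHessian hx hγV hs (hγ s hs).2
    have e2 := (e1.clm_apply (hasDerivWithinAt_const s _ u)).clm_apply
      (hasDerivWithinAt_const s _ u)
    simp only [map_zero, add_zero] at e2
    have e3 := (hasDerivWithinAt_id s (Icc (0 : ℝ) 1)).mul_const ⟪η, α⟫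
    rw [one_mul] at e3
    exact e2.neg.add e3
  · intro s hs
    have e1 := hasDerivWithinAt_segDeriv one_ne_zero h.contDiffOn_segDeriv_costHessian hx hγV hs
      (hγ s hs).2
    have e2 := ((e1.clm_apply (hasDerivWithinAt_const s _ η)).clm_apply
      (hasDerivWithinAt_const s _ u)).clm_apply (hasDerivWithinAt_const s _ u)
    simp only [map_zero, add_zero] at e2
    exact e2.neg.add_const _
  · intro s hs
    have e1 := apply_le_of_nonpos_of_inner_eq_zero (segHessian c U V (x, γ s)) η
      (fun ξ' hξ' => h.segHessian_nonpos hB3 ⟨hx, hγV s hs⟩ hξ') ξ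
    have e2 : 2 * ‖segHessian c U V (x, γ s)‖ * ‖η‖ * ‖ξ‖ * |⟪η, ξ⟫| ≤
        2 * S * ‖η‖ * ‖ξ‖ * |⟪η, ξ⟫| := by
      gcongr
      exact hS _ ⟨hx, hγV s hs⟩
    linarith
  -- the initial slope vanishes, since `D_y c(x(t), ȳ)` is affine along the curve
  · simp only [hγ0]
    set l := -(mixedHessian c U V x ybar).inverse η with hl
    have e1 : segDeriv c U V (costHessian c U V) (x, ybar) η u u =
        ⟪mixedThird c U V x ybar ξ l, ξ⟫ := by
      rw [h.inner_mixedThird (z := (x, ybar)) ⟨hx, hyb⟩]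
      rfl
    have e2 := hacc l
    rw [hl, map_neg, h.mixedHessian_inverse_apply hx hyb, inner_neg_left, ← hl] at e2
    rw [e1]
    linarith

theorem modCost_le_max_of_mem_open (hB3 : CondB3 c U V) (hyb : ybar ∈ closure V) {y : Eu n}
    (hy : y ∈ closure V) {q₀ q₁ : Eu n} (hq₀ : q₀ ∈ domFrom c U V ybar)
    (hq₁ : q₁ ∈ domFrom c U V ybar) {t : ℝ} (ht : t ∈ Icc (0 : ℝ) 1) :
    -modCost c U V ybar (q₀ + t • (q₁ - q₀)) y ≤
      max (-modCost c U V ybar q₀ y) (-modCost c U V ybar q₁ y) := by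
  obtain ⟨S, hS⟩ := h.isCompact.exists_bound_of_continuousOn (f := segHessian c U V)
    h.continuousOn_segHessian
  obtain ⟨A, hA⟩ := h.isCompact.exists_bound_of_continuousOn h.contDiffOn_gradFst.continuousOn
  obtain ⟨J, hJ⟩ := h.isCompact.exists_bound_of_continuousOn h.contDiffOn_inverse.continuousOn
  set ζ := q₁ - q₀ with hζ
  set x : ℝ → Eu n := fun t => costExp c U V ybar (q₀ + t • ζ) with hxdef
  set x₁ : ℝ → Eu n := fun t =>
    -ContinuousLinearMap.adjoint (mixedHessian c U V (x t) ybar).inverse ζ with hx₁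
  have hqt : ∀ t ∈ Icc (0 : ℝ) 1, q₀ + t • ζ ∈ domFrom c U V ybar := fun t ht =>
    (h.b2.1 ybar hyb).add_smul_sub_mem hq₀ hq₁ ht
  have hxU : ∀ t ∈ Icc (0 : ℝ) 1, x t ∈ U := fun t ht => h.costExp_mem_open hyb (hqt t ht)
  have hline : ∀ t : ℝ, HasDerivAt (fun t : ℝ => q₀ + t • ζ) ζ t := fun t => by
    simpa using ((hasDerivAt_id t).smul_const ζ).const_add q₀
  have hxd : ∀ t ∈ Icc (0 : ℝ) 1, HasDerivAt x (x₁ t) t := fun t ht => by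
    have e1 := ((h.hasFDerivWithinAt_costExp hyb (subset_closure (hqt t ht))).hasFDerivAt
      (Filter.mem_of_superset ((h.isOpen_domFrom hyb).mem_nhds (hqt t ht))
        subset_closure)).comp_hasDerivAt t (hline t)
    exact e1
  have hxc : ∀ t ∈ Icc (0 : ℝ) 1, closure U ∈ 𝓝 (x t) := fun t ht =>
    Filter.mem_of_superset (h.isOpen_fst.mem_nhds (hxU t ht)) subset_closure
  have hxcl : ∀ t ∈ Icc (0 : ℝ) 1, x t ∈ closure U := fun t ht => subset_closure (hxU t ht)
  -- derivatives along the curve of maps defined on `closure U`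
  have hMd : ∀ t ∈ Icc (0 : ℝ) 1, HasDerivAt (fun t => mixedHessian c U V (x t) ybar)
      (mixedThird c U V (x t) ybar (x₁ t)) t := fun t ht => by
    have e1 := ((h.hasFDerivWithinAt_mixedHessian (z := (x t, ybar)) ⟨hxcl t ht, hyb⟩).hasFDerivAt
      (hxc t ht)).comp_hasDerivAt t (hxd t ht)
    exact e1
  have hAd : ∀ y ∈ closure V, ∀ t ∈ Icc (0 : ℝ) 1, HasDerivAt (fun t => gradFst c U (x t) y)
      (fderivWithin ℝ (fun z : Eu n × Eu n => gradFst c U z.1 z.2) (closure U ×ˢ closure V)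
        (x t, y) (x₁ t, 0)) t := fun y hy t ht => by
    have e1 := (hasFDerivWithinAt_comp_mk_right (x := x t) (y := y) hy
      (h.contDiffOn_gradFst.differentiableOn (by norm_num) (x t, y)
        ⟨hxcl t ht, hy⟩)).hasFDerivAt (hxc t ht)
    have e2 := e1.comp_hasDerivAt t (hxd t ht)
    rw [ContinuousLinearMap.comp_apply, ContinuousLinearMap.inl_apply] at e2
    exact e2
  have hacc : ∀ t ∈ Icc (0 : ℝ) 1, ∃ α, HasDerivAt x₁ α t := fun t ht => by
    have e1 := (hasFDerivWithinAt_comp_mk_right (x := x t) (y := ybar) hyb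
      (h.contDiffOn_inverse.differentiableOn two_ne_zero (x t, ybar)
        ⟨hxcl t ht, hyb⟩)).hasFDerivAt (hxc t ht)
    have e2 := e1.comp_hasDerivAt t (hxd t ht)
    exact ⟨_, (differentiableAt_adjoint_apply e2.differentiableAt ζ).neg.hasDerivAt⟩
  choose! x₂ hx₂ using hacc
  have haff : ∀ t ∈ Icc (0 : ℝ) 1, ∀ l : Eu n, ⟪mixedHessian c U V (x t) ybar l, x₂ t⟫ +
      ⟪mixedThird c U V (x t) ybar (x₁ t) l, x₁ t⟫ = 0 := by
    intro t ht l
    have e1 := ((hMd t ht).clm_apply (hasDerivAt_const t l)).inner ℝ (hx₂ t ht)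
    have hnear : ∀ᶠ s in 𝓝 t, q₀ + s • ζ ∈ domFrom c U V ybar :=
      (hline t).continuousAt.eventually ((h.isOpen_domFrom hyb).mem_nhds (hqt t ht))
    have e2 : (fun s => ⟪mixedHessian c U V (x s) ybar l, x₁ s⟫) =ᶠ[𝓝 t] fun _ => -⟪l, ζ⟫ := by
      filter_upwards [hnear] with s hs
      have hxs : x s ∈ closure U := subset_closure (h.costExp_mem_open hyb hs)
      simp only [hx₁]
      rw [inner_neg_right, ContinuousLinearMap.adjoint_inner_right,
        h.inverse_mixedHessian_apply hxs hyb]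
    have e3 := (e1.congr_of_eventuallyEq e2.symm).unique (hasDerivAt_const t _)
    simpa using e3
  set η : ℝ → Eu n := fun t => gradFst c U (x t) ybar - gradFst c U (x t) y with hη
  have hcd : ∀ y ∈ closure V, ∀ t ∈ Icc (0 : ℝ) 1, HasDerivAt (fun t => c (x t) y)
      ⟪gradFst c U (x t) y, x₁ t⟫ t := fun y hy t ht => by
    have e1 := ((h.hasGradientWithinAt_cost (hxcl t ht) hy).hasFDerivWithinAt.hasFDerivAt
      (hxc t ht)).comp_hasDerivAt t (hxd t ht)
    rwa [InnerProductSpace.toDual_apply_apply] at e1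
  have hF : ∀ t ∈ Icc (0 : ℝ) 1, HasDerivAt (fun t => -modCost c U V ybar (q₀ + t • ζ) y)
      ⟪η t, x₁ t⟫ t := fun t ht => by
    have e1 := ((hcd y hy t ht).sub (hcd ybar hyb t ht)).neg
    have e2 : -(⟪gradFst c U (x t) y, x₁ t⟫ - ⟪gradFst c U (x t) ybar, x₁ t⟫) = ⟪η t, x₁ t⟫ := by
      rw [hη, inner_sub_left]; ring
    rw [e2] at e1
    exact e1
  have hF' : ∀ t ∈ Icc (0 : ℝ) 1, HasDerivAt (fun t => ⟪η t, x₁ t⟫)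
      (-costHessian c U V (x t, y) (x₁ t, 0) (x₁ t, 0) +
        costHessian c U V (x t, ybar) (x₁ t, 0) (x₁ t, 0) + ⟪η t, x₂ t⟫) t := fun t ht => by
    have e1 := ((hAd ybar hyb t ht).sub (hAd y hy t ht)).inner ℝ (hx₂ t ht)
    refine e1.congr_deriv ?_
    rw [inner_sub_left, h.inner_fderivWithin_gradFst (z := (x t, ybar)) ⟨hxcl t ht, hyb⟩,
      h.inner_fderivWithin_gradFst (z := (x t, y)) ⟨hxcl t ht, hy⟩]
    simp only [costHessian, hη, Pi.sub_apply]
    ring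
  have hS0 : 0 ≤ S := (norm_nonneg (segHessian c U V (x t, y))).trans (hS (x t, y) ⟨hxcl t ht, hy⟩)
  have hJ0 : 0 ≤ J := (norm_nonneg _).trans (hJ (x t, y) ⟨hxcl t ht, hy⟩)
  have hA0 : 0 ≤ A := (norm_nonneg _).trans (hA (x t, y) ⟨hxcl t ht, hy⟩)
  have hbound : ∀ t ∈ Icc (0 : ℝ) 1, -(2 * S * (A + A) * (J * ‖ζ‖)) * |⟪η t, x₁ t⟫| ≤
      -costHessian c U V (x t, y) (x₁ t, 0) (x₁ t, 0) +
        costHessian c U V (x t, ybar) (x₁ t, 0) (x₁ t, 0) + ⟪η t, x₂ t⟫ := fun t ht => by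
    refine le_trans ?_ (h.second_variation_ge hB3 hyb hS (hxcl t ht) hy (haff t ht))
    have e1 : ‖η t‖ ≤ A + A := (norm_sub_le _ _).trans
      (add_le_add (hA (x t, ybar) ⟨hxcl t ht, hyb⟩) (hA (x t, y) ⟨hxcl t ht, hy⟩))
    have e2 : ‖x₁ t‖ ≤ J * ‖ζ‖ := by
      rw [hx₁, norm_neg]
      refine (ContinuousLinearMap.le_opNorm _ _).trans ?_
      rw [LinearIsometryEquiv.norm_map]
      gcongr
      exact hJ (x t, ybar) ⟨hxcl t ht, hyb⟩
    rw [neg_mul]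
    apply neg_le_neg
    gcongr
  have := le_max_of_neg_mul_abs_deriv_le hF hF' hbound ht
  simpa [hζ] using this

/-- In cost exponential coordinates the functions `-c̃(·, y)` are quasiconvex. -/
theorem quasiconvexOn_neg_modCost (hB3 : CondB3 c U V) (hyb : ybar ∈ closure V) {y : Eu n}
    (hy : y ∈ closure V) :
    QuasiconvexOn ℝ (closure (domFrom c U V ybar)) (fun q => -modCost c U V ybar q y) := by
  have hconv : Convex ℝ (closure (domFrom c U V ybar)) := (h.b2.1 ybar hyb).closure
  refine quasiconvexOn_iff_le_max.2 ⟨hconv, fun p hp q hq a b ha hb hab => ?_⟩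
  set D := domFrom c U V ybar with hD
  have hcont : ContinuousOn (fun q => modCost c U V ybar q y) (closure D) :=
    (h.continuousOn_modCost hyb).comp (continuousOn_id.prodMk continuousOn_const)
      (fun q hq => ⟨hq, hy⟩)
  have hpq : (p, q) ∈ closure (D ×ˢ D) := by rw [closure_prod_eq]; exact ⟨hp, hq⟩
  have hne : (𝓝[D ×ˢ D] (p, q)).NeBot := mem_closure_iff_nhdsWithin_neBot.1 hpq
  have hsub : D ×ˢ D ⊆ closure D ×ˢ closure D := prod_mono subset_closure subset_closure
  have h1 : ContinuousOn (fun z : Eu n × Eu n => -modCost c U V ybar (a • z.1 + b • z.2) y)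
      (closure D ×ˢ closure D) :=
    (hcont.comp (by fun_prop) (fun z hz => hconv hz.1 hz.2 ha hb hab)).neg
  have h2 : ContinuousOn (fun z : Eu n × Eu n => -modCost c U V ybar z.1 y)
      (closure D ×ˢ closure D) := (hcont.comp continuousOn_fst (fun z hz => hz.1)).neg
  have h3 : ContinuousOn (fun z : Eu n × Eu n => -modCost c U V ybar z.2 y)
      (closure D ×ˢ closure D) := (hcont.comp continuousOn_snd (fun z hz => hz.2)).neg
  refine le_of_tendsto_of_tendsto ((h1 (p, q) ⟨hp, hq⟩).mono hsub)
    (((h2 (p, q) ⟨hp, hq⟩).mono hsub).max ((h3 (p, q) ⟨hp, hq⟩).mono hsub)) ?_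
  filter_upwards [self_mem_nhdsWithin] with z hz
  have := h.modCost_le_max_of_mem_open hB3 hyb hy hz.1 hz.2 (t := b) ⟨hb, by linarith⟩
  have heq : z.1 + b • (z.2 - z.1) = a • z.1 + b • z.2 := by
    rw [← eq_sub_iff_add_eq] at hab
    rw [hab]; module
  rwa [heq] at this

end RegularCost

end Quasiconvexity

/-! ### Variation of the gradient of the modified cost -/

section GradientVariation

variable {n : ℕ} {c : Eu n → Eu n → ℝ} {U V : Set (Eu n)} {ybar : Eu n}

/-- The gradient of `-c̃(·, y)` at `q`, where `c̃` is the modified cost at `ȳ`. -/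
def modGrad (c : Eu n → Eu n → ℝ) (U V : Set (Eu n)) (ybar q y : Eu n) : Eu n :=
  (mixedHessian c U V (costExp c U V ybar q) ybar).inverse
    (gradFst c U (costExp c U V ybar q) y - gradFst c U (costExp c U V ybar q) ybar)

namespace RegularCost

variable (h : RegularCost c U V)
include h

theorem hasGradientWithinAt_neg_modCost (hyb : ybar ∈ closure V) {q y : Eu n}
    (hq : q ∈ closure (domFrom c U V ybar)) (hy : y ∈ closure V) :
    HasGradientWithinAt (fun q => -modCost c U V ybar q y) (modGrad c U V ybar q y)
      (closure (domFrom c U V ybar)) q := by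
  have h1 := (h.hasGradientWithinAt_modCost hyb hq hy).hasFDerivWithinAt.neg
  rw [map_neg, neg_neg] at h1
  exact h1

/-- The gradient of `-c̃(·, y)` varies slowly relative to its own size. The difference
`D_x c(x, y) - D_x c(x, ȳ)` is integrated along a segment from `ȳ` to `y` with respect to the base
point, which has length at most `β⁻` times the value of that difference there. -/
theorem norm_modGrad_sub_le (hyb : ybar ∈ closure V) {bp bm d : ℝ}
    (hbp : ∀ z ∈ closure U ×ˢ closure V, ‖mixedHessian c U V z.1 z.2‖ ≤ bp)
    (hbm : ∀ z ∈ closure U ×ˢ closure V, ‖(mixedHessian c U V z.1 z.2).inverse‖ ≤ bm)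
    (hd : ∀ z ∈ closure U ×ˢ closure V, ‖mixedThird c U V z.1 z.2‖ ≤ d)
    {q₀ q₁ y : Eu n} (hq₀ : q₀ ∈ closure (domFrom c U V ybar))
    (hq₁ : q₁ ∈ closure (domFrom c U V ybar)) (hy : y ∈ closure V) :
    ‖modGrad c U V ybar q₁ y - modGrad c U V ybar q₀ y‖ ≤
      2 * bp ^ 4 * bm ^ 6 * d * ‖q₁ - q₀‖ * ‖modGrad c U V ybar q₀ y‖ := by
  set D := closure (domFrom c U V ybar) with hD
  have hDc : Convex ℝ D := (h.b2.1 ybar hyb).closure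
  set x₀ := costExp c U V ybar q₀ with hx₀
  set x₁ := costExp c U V ybar q₁ with hx₁
  have hx₀U : x₀ ∈ closure U := h.costExp_mem hyb hq₀
  have hx₁U : x₁ ∈ closure U := h.costExp_mem hyb hq₁
  have hbp0 : 0 ≤ bp := (norm_nonneg _).trans (hbp (x₀, y) ⟨hx₀U, hy⟩)
  have hbm0 : 0 ≤ bm := (norm_nonneg _).trans (hbm (x₀, y) ⟨hx₀U, hy⟩)
  have hd0 : 0 ≤ d :=
    (norm_nonneg (mixedThird c U V x₀ y)).trans (hd (x₀, y) ⟨hx₀U, hy⟩)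
  have hM : ∀ y ∈ closure V, ‖mixedHessian c U V x₁ y - mixedHessian c U V x₀ y‖ ≤
      d * bm * ‖q₁ - q₀‖ := by
    intro y hy
    refine hDc.norm_image_sub_le_of_norm_hasFDerivWithin_le
      (f := fun q => mixedHessian c U V (costExp c U V ybar q) y)
      (f' := fun q => (mixedThird c U V (costExp c U V ybar q) y).comp
        (-ContinuousLinearMap.adjoint (mixedHessian c U V (costExp c U V ybar q) ybar).inverse))
      (fun q hq => ?_) (fun q hq => ?_) hq₀ hq₁
    · exact (h.hasFDerivWithinAt_mixedHessian (z := (costExp c U V ybar q, y))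
        ⟨h.costExp_mem hyb hq, hy⟩).comp q (h.hasFDerivWithinAt_costExp hyb hq)
          (fun p hp => h.costExp_mem hyb hp)
    · refine (ContinuousLinearMap.opNorm_comp_le _ _).trans ?_
      rw [norm_neg, LinearIsometryEquiv.norm_map]
      exact mul_le_mul (hd (_, y) ⟨h.costExp_mem hyb hq, hy⟩)
        (hbm (_, ybar) ⟨h.costExp_mem hyb hq, hyb⟩) (norm_nonneg _) hd0
  set P₀ := gradFst c U x₀ y - gradFst c U x₀ ybar with hP₀
  set P₁ := gradFst c U x₁ y - gradFst c U x₁ ybar with hP₁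
  have hP : ‖P₁ - P₀‖ ≤ d * bm ^ 2 * ‖q₁ - q₀‖ * ‖P₀‖ := by
    obtain ⟨γ, hγ0, hγ1, hγ⟩ := h.exists_curve_snd_Icc hx₀U hyb hy
    have hder : ∀ s ∈ Icc (0 : ℝ) 1, HasDerivWithinAt
        (fun s => gradFst c U x₁ (γ s) - gradFst c U x₀ (γ s))
        ((mixedHessian c U V x₁ (γ s) - mixedHessian c U V x₀ (γ s))
          (-(mixedHessian c U V x₀ (γ s)).inverse (gradFst c U x₀ ybar - gradFst c U x₀ y)))
        (Icc 0 1) s := by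
      intro s hs
      have e1 := (h.hasFDerivWithinAt_gradFst (z := (x₁, γ s)) ⟨hx₁U, (hγ s hs).1⟩).sub
        (h.hasFDerivWithinAt_gradFst (z := (x₀, γ s)) ⟨hx₀U, (hγ s hs).1⟩)
      exact e1.comp_hasDerivWithinAt s (hγ s hs).2 (fun s hs => (hγ s hs).1)
    have := norm_image_sub_le_of_norm_deriv_le_segment_01' hder
      (C := (d * bm * ‖q₁ - q₀‖) * (bm * ‖P₀‖)) (fun s hs => by
        have hs' := Ico_subset_Icc_self hs
        refine (ContinuousLinearMap.le_opNorm _ _).trans ?_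
        refine mul_le_mul (hM _ (hγ s hs').1) ?_ (norm_nonneg _) (by positivity)
        rw [norm_neg]
        refine (ContinuousLinearMap.le_opNorm _ _).trans ?_
        rw [norm_sub_rev (gradFst c U x₀ ybar)]
        exact mul_le_mul_of_nonneg_right (hbm (x₀, γ s) ⟨hx₀U, (hγ s hs').1⟩) (norm_nonneg _))
    simp only [hγ0, hγ1] at this
    have heq : gradFst c U x₁ y - gradFst c U x₀ y - (gradFst c U x₁ ybar - gradFst c U x₀ ybar) =
        P₁ - P₀ := by rw [hP₀, hP₁]; abel
    rw [heq] at this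
    exact this.trans (le_of_eq (by ring))
  set N₀ := (mixedHessian c U V x₀ ybar).inverse with hN₀
  set N₁ := (mixedHessian c U V x₁ ybar).inverse with hN₁
  have hN₀n : ‖N₀‖ ≤ bm := hbm (x₀, ybar) ⟨hx₀U, hyb⟩
  have hN₁n : ‖N₁‖ ≤ bm := hbm (x₁, ybar) ⟨hx₁U, hyb⟩
  have hP₀N : mixedHessian c U V x₀ ybar (N₀ P₀) = P₀ := h.mixedHessian_inverse_apply hx₀U hyb P₀
  have hsplit : N₁ P₁ - N₀ P₀ = N₁ (P₁ - P₀) -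
      N₁ ((mixedHessian c U V x₁ ybar - mixedHessian c U V x₀ ybar) (N₀ P₀)) := by
    rw [sub_apply, hP₀N, map_sub N₁ P₁ P₀, map_sub N₁ _ P₀, hN₁,
      h.inverse_mixedHessian_apply hx₁U hyb]
    abel
  have hbase : ‖N₁ P₁ - N₀ P₀‖ ≤ 2 * bm ^ 3 * d * ‖q₁ - q₀‖ * ‖P₀‖ := by
    have e1 : ‖N₁ (P₁ - P₀)‖ ≤ bm * (d * bm ^ 2 * ‖q₁ - q₀‖ * ‖P₀‖) :=
      (N₁.le_opNorm _).trans (mul_le_mul hN₁n hP (norm_nonneg _) hbm0)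
    have e2 : ‖N₁ ((mixedHessian c U V x₁ ybar - mixedHessian c U V x₀ ybar) (N₀ P₀))‖ ≤
        bm * ((d * bm * ‖q₁ - q₀‖) * (bm * ‖P₀‖)) := by
      refine (N₁.le_opNorm _).trans (mul_le_mul hN₁n ?_ (norm_nonneg _) hbm0)
      refine (ContinuousLinearMap.le_opNorm _ _).trans
        (mul_le_mul (hM ybar hyb) ?_ (norm_nonneg _) (by positivity))
      exact (N₀.le_opNorm _).trans (mul_le_mul_of_nonneg_right hN₀n (norm_nonneg _))
    rw [hsplit]
    refine (norm_sub_le _ _).trans ((add_le_add e1 e2).trans (le_of_eq (by ring)))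
  have hP₀le : ‖P₀‖ ≤ bp * ‖N₀ P₀‖ := by
    nth_rewrite 1 [← hP₀N]
    exact (ContinuousLinearMap.le_opNorm _ _).trans
      (mul_le_mul_of_nonneg_right (hbp (x₀, ybar) ⟨hx₀U, hyb⟩) (norm_nonneg _))
  change ‖N₁ P₁ - N₀ P₀‖ ≤ 2 * bp ^ 4 * bm ^ 6 * d * ‖q₁ - q₀‖ * ‖N₀ P₀‖
  rcases eq_or_ne P₀ 0 with h0 | h0
  · exact (hbase.trans (le_of_eq (by rw [h0, norm_zero, mul_zero]))).trans (by positivity)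
  -- `β⁺ β⁻ ≥ 1` brings the estimate to the form with the exponents of `ε_c`
  have hone : 1 ≤ bp * bm := by
    have hpos : 0 < ‖P₀‖ := norm_pos_iff.2 h0
    have e1 : ‖P₀‖ ≤ bp * bm * ‖P₀‖ := hP₀le.trans (by
      rw [mul_assoc]
      exact mul_le_mul_of_nonneg_left ((N₀.le_opNorm _).trans
        (mul_le_mul_of_nonneg_right hN₀n (norm_nonneg _))) hbp0)
    exact le_of_mul_le_mul_right (by rwa [one_mul]) hpos
  calc ‖N₁ P₁ - N₀ P₀‖ ≤ 2 * bm ^ 3 * d * ‖q₁ - q₀‖ * ‖P₀‖ := hbase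
    _ ≤ 2 * bm ^ 3 * d * ‖q₁ - q₀‖ * (bp * ‖N₀ P₀‖) := by gcongr
    _ = (2 * bm ^ 3 * d * ‖q₁ - q₀‖ * (bp * ‖N₀ P₀‖)) * 1 := (mul_one _).symm
    _ ≤ (2 * bm ^ 3 * d * ‖q₁ - q₀‖ * (bp * ‖N₀ P₀‖)) * (bp * bm) ^ 3 := by
        gcongr
        exact one_le_pow₀ hone
    _ = 2 * bp ^ 4 * bm ^ 6 * d * ‖q₁ - q₀‖ * ‖N₀ P₀‖ := by ring

end RegularCost

end GradientVariation

/-! ### Volumes of ellipsoids and change of variables -/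

section Volumes

variable {n : ℕ}

theorem det_adjoint (L : Eu n →L[ℝ] Eu n) :
    LinearMap.det (ContinuousLinearMap.adjoint L : Eu n →ₗ[ℝ] Eu n) =
      LinearMap.det (L : Eu n →ₗ[ℝ] Eu n) := by
  let b := EuclideanSpace.basisFun (Fin n) ℝ
  rw [← LinearMap.det_toMatrix b.toBasis, ← LinearMap.det_toMatrix b.toBasis]
  have : (ContinuousLinearMap.adjoint L : Eu n →ₗ[ℝ] Eu n) =
      LinearMap.adjoint (L : Eu n →ₗ[ℝ] Eu n) := rfl
  rw [this, LinearMap.toMatrix_adjoint, Matrix.det_conjTranspose]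
  simp

open scoped Pointwise in
theorem volume_ellipsoid (a : Eu n) (L : Eu n ≃L[ℝ] Eu n) {r : ℝ} (hr : 0 ≤ r) :
    volume (ellipsoid a L r) =
      ENNReal.ofReal |LinearMap.det ((L : Eu n →L[ℝ] Eu n) : Eu n →ₗ[ℝ] Eu n)| *
        (ENNReal.ofReal (r ^ n) * volume (Metric.closedBall (0 : Eu n) 1)) := by
  have h1 : ellipsoid a L r = (fun v => a + v) '' ((L : Eu n →L[ℝ] Eu n) ''
      (r • Metric.closedBall (0 : Eu n) 1)) := by
    rw [ellipsoid, ← image_smul, image_image, image_image]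
    simp
  rw [h1, image_add_left, measure_preimage_add, Measure.addHaar_image_continuousLinearMap,
    Measure.addHaar_smul, finrank_euclideanSpace_fin, abs_of_nonneg (pow_nonneg hr n)]

/-- The volume of the body dual to an ellipsoid. -/
theorem volume_adjoint_le (L : Eu n ≃L[ℝ] Eu n) {r : ℝ} (hr : 0 ≤ r) :
    ENNReal.ofReal |LinearMap.det ((L : Eu n →L[ℝ] Eu n) : Eu n →ₗ[ℝ] Eu n)| *
      volume {p : Eu n | ‖ContinuousLinearMap.adjoint (L : Eu n →L[ℝ] Eu n) p‖ ≤ r} =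
      ENNReal.ofReal (r ^ n) * volume (Metric.closedBall (0 : Eu n) 1) := by
  have hdet : LinearMap.det ((L : Eu n →L[ℝ] Eu n) : Eu n →ₗ[ℝ] Eu n) ≠ 0 :=
    (LinearEquiv.isUnit_det' L.toLinearEquiv).ne_zero
  have h1 : {p : Eu n | ‖ContinuousLinearMap.adjoint (L : Eu n →L[ℝ] Eu n) p‖ ≤ r} =
      ContinuousLinearMap.adjoint (L : Eu n →L[ℝ] Eu n) ⁻¹' Metric.closedBall 0 r := by
    ext p; simp
  rw [h1, Measure.addHaar_preimage_continuousLinearMap _ (by rwa [det_adjoint]), det_adjoint,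
    Measure.addHaar_closedBall' _ _ hr, finrank_euclideanSpace_fin, ← mul_assoc,
    ← ENNReal.ofReal_mul (abs_nonneg _), abs_inv, mul_inv_cancel₀ (abs_ne_zero.2 hdet),
    ENNReal.ofReal_one, one_mul]

theorem isCompact_ellipsoid (a : Eu n) (L : Eu n ≃L[ℝ] Eu n) (r : ℝ) :
    IsCompact (ellipsoid a L r) :=
  (isCompact_closedBall 0 1).image (by fun_prop)

/-- A change of variables: if `1 ≤ γ |det f'|` on a set, its volume is at most `γ` times that of its
image. -/
theorem volume_le_mul_volume_image {f : Eu n → Eu n} {f' : Eu n → Eu n →L[ℝ] Eu n} {Y : Set (Eu n)}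
    (hY : MeasurableSet Y) (hf : ∀ y ∈ Y, HasFDerivWithinAt f (f' y) Y y) (hinj : InjOn f Y)
    {γ : ENNReal} (hγ : ∀ y ∈ Y, 1 ≤ γ * ENNReal.ofReal |(f' y).det|) :
    volume Y ≤ γ * volume (f '' Y) := by
  rw [← lintegral_abs_det_fderiv_eq_addHaar_image volume hY hf hinj,
    ← lintegral_const_mul'' _ (aemeasurable_ofReal_abs_det_fderivWithin volume hY hf)]
  calc volume Y = ∫⁻ _ in Y, 1 := by simp
    _ ≤ _ := setLIntegral_mono' hY hγ

end Volumes

/-! ### The determinant of the modified cost, and sections -/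

section Estimate

variable {n : ℕ} {c : Eu n → Eu n → ℝ} {U V : Set (Eu n)} {ybar : Eu n}

theorem norm_adjoint_apply_le_of_inner_le {L : Eu n →L[ℝ] Eu n} {p : Eu n} {r : ℝ} (hr : 0 ≤ r)
    (hp : ∀ v, ‖v‖ ≤ 1 → ⟪p, L v⟫ ≤ r) : ‖ContinuousLinearMap.adjoint L p‖ ≤ r := by
  set w := ContinuousLinearMap.adjoint L p with hw
  rcases eq_or_ne w 0 with h0 | h0
  · rwa [h0, norm_zero]
  have hwn : ‖w‖ ≠ 0 := norm_ne_zero_iff.2 h0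
  have h1 := hp (‖w‖⁻¹ • w) (by rw [norm_smul, norm_inv, norm_norm, inv_mul_cancel₀ hwn])
  rwa [← ContinuousLinearMap.adjoint_inner_left, ← hw, inner_smul_right, real_inner_self_eq_norm_sq,
    sq, inv_mul_cancel_left₀ hwn] at h1

/-- The comparison of volumes in extended nonnegative reals. Here `D = |det L|`, `κ` is the volume of
the unit ball, `v` that of `Q`, and `P` that of the body dual to the ellipsoid `E`; the factor `30` is
`15 * 2`, from the slope bound and from halving the ellipsoid. -/
theorem sq_le_of_volume_ineq {D δ lam H : ℝ} (hD : 0 < D) (hδ : 0 < δ) (hlam : 0 < lam) (hH : 0 ≤ H)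
    {κ γ v P : ENNReal} (hκ0 : κ ≠ 0) (hκ : κ ≠ ⊤)
    (hv : v ≤ ENNReal.ofReal D * (ENNReal.ofReal ((n : ℝ) ^ n) * κ))
    (hP : ENNReal.ofReal D * P = ENNReal.ofReal ((15 * H / δ) ^ n) * κ)
    (hMA : ENNReal.ofReal lam * (ENNReal.ofReal D * (ENNReal.ofReal ((δ / 2) ^ n) * κ)) ≤ γ * P) :
    v ^ 2 ≤ ENNReal.ofReal (((n : ℝ) ^ n) ^ 2 * κ.toReal ^ 2 * 30 ^ n) *
      (γ / ENNReal.ofReal (δ ^ (2 * n) * lam)) * ENNReal.ofReal (H ^ n) := by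
  have h1 : ENNReal.ofReal (lam * D ^ 2 * (δ / 2) ^ n) ≤
      γ * ENNReal.ofReal ((15 * H / δ) ^ n) := by
    have h2 := mul_le_mul_right hMA (ENNReal.ofReal D)
    rw [mul_left_comm _ γ P, hP, ← mul_assoc γ] at h2
    have h3 : ENNReal.ofReal D * (ENNReal.ofReal lam * (ENNReal.ofReal D *
        (ENNReal.ofReal ((δ / 2) ^ n) * κ))) = ENNReal.ofReal (lam * D ^ 2 * (δ / 2) ^ n) * κ := by
      rw [ENNReal.ofReal_mul (by positivity), ENNReal.ofReal_mul hlam.le, sq,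
        ENNReal.ofReal_mul hD.le]
      ring
    rw [h3] at h2
    exact (ENNReal.mul_le_mul_iff_left hκ0 hκ).1 h2
  have h4 : ENNReal.ofReal (D ^ 2) ≤
      ENNReal.ofReal (30 ^ n) * (γ / ENNReal.ofReal (δ ^ (2 * n) * lam)) *
        ENNReal.ofReal (H ^ n) := by
    have hk : 0 < 2 ^ n / (lam * δ ^ n) := by positivity
    have h5 := mul_le_mul_left h1 (ENNReal.ofReal (2 ^ n / (lam * δ ^ n)))
    rw [← ENNReal.ofReal_mul (by positivity), mul_assoc γ,
      ← ENNReal.ofReal_mul (by positivity)] at h5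
    have e1 : lam * D ^ 2 * (δ / 2) ^ n * (2 ^ n / (lam * δ ^ n)) = D ^ 2 := by
      rw [div_pow]; field_simp
    have e2 : (15 * H / δ) ^ n * (2 ^ n / (lam * δ ^ n)) =
        30 ^ n * (δ ^ (2 * n) * lam)⁻¹ * H ^ n := by
      rw [div_pow, mul_pow, show (30 : ℝ) = 15 * 2 by norm_num, mul_pow, two_mul, pow_add]
      field_simp
    rw [e1, e2, ENNReal.ofReal_mul (by positivity), ENNReal.ofReal_mul (by positivity),
      ENNReal.ofReal_inv_of_pos (by positivity)] at h5
    refine h5.trans (le_of_eq ?_)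
    rw [div_eq_mul_inv]
    ring
  calc v ^ 2 ≤ (ENNReal.ofReal D * (ENNReal.ofReal ((n : ℝ) ^ n) * κ)) ^ 2 := by gcongr
    _ = ENNReal.ofReal (((n : ℝ) ^ n) ^ 2 * κ.toReal ^ 2) * ENNReal.ofReal (D ^ 2) := by
        rw [ENNReal.ofReal_mul (by positivity), ENNReal.ofReal_pow (p := (n : ℝ) ^ n) (by positivity),
          ENNReal.ofReal_pow (p := κ.toReal) (by positivity), ENNReal.ofReal_pow hD.le,
          ENNReal.ofReal_toReal hκ]
        ring
    _ ≤ ENNReal.ofReal (((n : ℝ) ^ n) ^ 2 * κ.toReal ^ 2) * (ENNReal.ofReal (30 ^ n) *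
          (γ / ENNReal.ofReal (δ ^ (2 * n) * lam)) * ENNReal.ofReal (H ^ n)) := by gcongr
    _ = _ := by
        rw [ENNReal.ofReal_mul (p := ((n : ℝ) ^ n) ^ 2 * κ.toReal ^ 2) (by positivity)]
        ring

namespace RegularCost

variable (h : RegularCost c U V)
include h

theorem eLpNorm_ne_top {F : Type*} [NormedAddCommGroup F] {f : Eu n × Eu n → F}
    (hf : ContinuousOn f (closure U ×ˢ closure V)) :
    eLpNorm f ⊤ (volume.restrict (U ×ˢ V)) ≠ ⊤ := by
  obtain ⟨B, hB⟩ := h.isCompact.exists_bound_of_continuousOn hf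
  rw [eLpNorm_exponent_top]
  refine ((eLpNormEssSup_le_of_ae_bound (C := B) ?_).trans_lt ENNReal.ofReal_lt_top).ne
  filter_upwards [ae_restrict_mem (h.isOpen_fst.prod h.isOpen_snd).measurableSet] with z hz
  exact hB z ⟨subset_closure hz.1, subset_closure hz.2⟩

theorem norm_le_toReal_eLpNorm {F : Type*} [NormedAddCommGroup F] {f : Eu n × Eu n → F}
    (hf : ContinuousOn f (closure U ×ˢ closure V)) {z : Eu n × Eu n}
    (hz : z ∈ closure U ×ˢ closure V) :
    ‖f z‖ ≤ (eLpNorm f ⊤ (volume.restrict (U ×ˢ V))).toReal := by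
  have hpos : (volume : Measure (Eu n × Eu n)).IsOpenPosMeasure :=
    inferInstanceAs ((volume : Measure (Eu n)).prod (volume : Measure (Eu n))).IsOpenPosMeasure
  have h1 := enorm_le_eLpNorm_top_of_continuousOn (μ := volume) (T := U ×ˢ V)
    (h.isOpen_fst.prod h.isOpen_snd) (prod_mono subset_closure subset_closure)
    (closure_prod_eq (s := U) (t := V)).ge Subset.rfl hf hz
  rw [← ENNReal.ofReal_toReal (h.eLpNorm_ne_top hf), ← ofReal_norm] at h1
  exact (ENNReal.ofReal_le_ofReal_iff ENNReal.toReal_nonneg).1 h1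

/-- The gradients in the definition of `γ⁻` are those given by `modGrad`, up to sign. -/
theorem gradFst_modCost (hyb : ybar ∈ closure V) {q y : Eu n}
    (hq : q ∈ closure (domFrom c U V ybar)) (hy : y ∈ closure V) :
    gradFst (modCost c U V ybar) (domFrom c U V ybar) q y = -modGrad c U V ybar q y := by
  have h1 := (h.hasGradientWithinAt_modCost hyb hq hy).hasFDerivWithinAt.fderivWithin
    (h.uniqueDiffOn_domFrom hyb q hq)
  rw [gradFst, gradientWithin, h1, LinearIsometryEquiv.symm_apply_apply]
  rfl

theorem hasFDerivWithinAt_modGrad (hyb : ybar ∈ closure V) {q y : Eu n}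
    (hq : q ∈ closure (domFrom c U V ybar)) (hy : y ∈ closure V) :
    HasFDerivWithinAt (fun y => -modGrad c U V ybar q y)
      (-(mixedHessian c U V (costExp c U V ybar q) ybar).inverse.comp
        (mixedHessian c U V (costExp c U V ybar q) y)) (closure V) y := by
  have h1 := (h.hasFDerivWithinAt_gradFst (z := (costExp c U V ybar q, y))
    ⟨h.costExp_mem hyb hq, hy⟩).sub_const (gradFst c U (costExp c U V ybar q) ybar)
  exact ((mixedHessian c U V (costExp c U V ybar q) ybar).inverse.hasFDerivAt.comp_hasFDerivWithinAt
    y h1).neg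

theorem mixedHessian_modCost (hyb : ybar ∈ closure V) {q y : Eu n}
    (hq : q ∈ closure (domFrom c U V ybar)) (hy : y ∈ closure V) :
    mixedHessian (modCost c U V ybar) (domFrom c U V ybar) V q y =
      -(mixedHessian c U V (costExp c U V ybar q) ybar).inverse.comp
        (mixedHessian c U V (costExp c U V ybar q) y) :=
  ((h.hasFDerivWithinAt_modGrad hyb hq hy).congr (fun _ hy => h.gradFst_modCost hyb hq hy)
    (h.gradFst_modCost hyb hq hy)).fderivWithin (h.uniqueDiffOn_snd y hy)

theorem det_mixedHessian_modCost_ne_zero (hyb : ybar ∈ closure V) {q y : Eu n}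
    (hq : q ∈ closure (domFrom c U V ybar)) (hy : y ∈ closure V) :
    (mixedHessian (modCost c U V ybar) (domFrom c U V ybar) V q y).det ≠ 0 := by
  have hx := h.costExp_mem hyb hq
  obtain ⟨e, he⟩ := (h.isInvertible_mixedHessian (z := (costExp c U V ybar q, ybar))
    ⟨hx, hyb⟩).inverse.comp (h.isInvertible_mixedHessian (z := (costExp c U V ybar q, y)) ⟨hx, hy⟩)
  have h1 : mixedHessian (modCost c U V ybar) (domFrom c U V ybar) V q y =
      ((e.trans (ContinuousLinearEquiv.neg ℝ) : Eu n ≃L[ℝ] Eu n) : Eu n →L[ℝ] Eu n) := by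
    rw [h.mixedHessian_modCost hyb hq hy]
    simp only at he
    rw [← he]
    ext1 v
    simp
  rw [h1]
  exact (LinearEquiv.isUnit_det' (e.trans (ContinuousLinearEquiv.neg ℝ)).toLinearEquiv).ne_zero

theorem continuousOn_det_mixedHessian_modCost (hyb : ybar ∈ closure V) :
    ContinuousOn (fun z : Eu n × Eu n =>
      (mixedHessian (modCost c U V ybar) (domFrom c U V ybar) V z.1 z.2).det)
      (closure (domFrom c U V ybar) ×ˢ closure V) := by
  have hX : ContinuousOn (fun z : Eu n × Eu n => costExp c U V ybar z.1)
      (closure (domFrom c U V ybar) ×ˢ closure V) :=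
    (h.continuousOn_costExp hyb).comp continuousOn_fst (fun z hz => hz.1)
  have h1 := h.contDiffOn_inverse.continuousOn.comp (hX.prodMk (continuousOn_const (c := ybar)))
    (fun z hz => ⟨h.costExp_mem hyb hz.1, hyb⟩)
  have h2 := h.contDiffOn_mixedHessian.continuousOn.comp (hX.prodMk continuousOn_snd)
    (fun z hz => ⟨h.costExp_mem hyb hz.1, hz.2⟩)
  refine (ContinuousLinearMap.continuous_det.comp_continuousOn (h1.clm_comp h2).neg).congr
    fun z hz => ?_
  change _ = ContinuousLinearMap.det _
  rw [h.mixedHessian_modCost hyb hz.1 hz.2]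
  rfl

theorem one_le_gammaMinus_mul (hyb : ybar ∈ closure V) {Q : Set (Eu n)}
    (hQ : Q ⊆ closure (domFrom c U V ybar)) {q y : Eu n} (hq : q ∈ interior Q)
    (hy : y ∈ closure V) :
    1 ≤ gammaMinus (modCost c U V ybar) (domFrom c U V ybar) V Q * ENNReal.ofReal
      |(mixedHessian (modCost c U V ybar) (domFrom c U V ybar) V q y).det| := by
  have hpos : (volume : Measure (Eu n × Eu n)).IsOpenPosMeasure :=
    inferInstanceAs ((volume : Measure (Eu n)).prod (volume : Measure (Eu n))).IsOpenPosMeasure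
  have hsub : interior Q ×ˢ closure V ⊆ closure (domFrom c U V ybar) ×ˢ closure V :=
    prod_mono (interior_subset.trans hQ) Subset.rfl
  have hcont : ContinuousOn (fun z : Eu n × Eu n =>
      ((mixedHessian (modCost c U V ybar) (domFrom c U V ybar) V z.1 z.2).det)⁻¹)
      (interior Q ×ˢ closure V) :=
    ((h.continuousOn_det_mixedHessian_modCost hyb).mono hsub).inv₀
      (fun z hz => h.det_mixedHessian_modCost_ne_zero hyb (hsub hz).1 hz.2)
  have h1 := enorm_le_eLpNorm_top_of_continuousOn (μ := volume) (T := Q ×ˢ V) (x := (q, y))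
    (isOpen_interior.prod h.isOpen_snd) (prod_mono Subset.rfl subset_closure)
    (by rw [closure_prod_eq]; exact prod_mono subset_closure Subset.rfl)
    (prod_mono interior_subset Subset.rfl) hcont ⟨hq, hy⟩
  have hne := h.det_mixedHessian_modCost_ne_zero hyb (hQ (interior_subset hq)) hy
  refine le_trans (le_of_eq ?_) (mul_le_mul_left h1 _)
  rw [← ofReal_norm, Real.norm_eq_abs, abs_inv, ← ENNReal.ofReal_mul (by positivity),
    inv_mul_cancel₀ (abs_ne_zero.2 hne), ENNReal.ofReal_one]

/-- The set of those `y` whose gradient at `q` lies in a body dual to an ellipsoid has volume at most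
`γ⁻` times that of the body, by the change of variables `y ↦ D_q c̃(q, y)`. -/
theorem volume_le_gammaMinus_mul (hyb : ybar ∈ closure V) {Q : Set (Eu n)}
    (hQ : Q ⊆ closure (domFrom c U V ybar)) {q : Eu n} (hq : q ∈ interior Q)
    {L : Eu n →L[ℝ] Eu n} {R : ℝ} :
    volume {y | y ∈ closure V ∧ ‖ContinuousLinearMap.adjoint L (modGrad c U V ybar q y)‖ ≤ R} ≤
      gammaMinus (modCost c U V ybar) (domFrom c U V ybar) V Q *
        volume {p : Eu n | ‖ContinuousLinearMap.adjoint L p‖ ≤ R} := by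
  have hqD := hQ (interior_subset hq)
  set Y := {y | y ∈ closure V ∧
    ‖ContinuousLinearMap.adjoint L (modGrad c U V ybar q y)‖ ≤ R} with hY
  have hYV : Y ⊆ closure V := fun y hy => hy.1
  have hcont : ContinuousOn (fun y => ‖ContinuousLinearMap.adjoint L (modGrad c U V ybar q y)‖)
      (closure V) := by
    have h1 : ContinuousOn (fun y => modGrad c U V ybar q y) (closure V) := fun y hy => by
      have e : (fun y => modGrad c U V ybar q y) = -fun y => -modGrad c U V ybar q y := by
        funext y; simp
      rw [e]
      exact (h.hasFDerivWithinAt_modGrad hyb hqD hy).continuousWithinAt.neg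
    exact ((ContinuousLinearMap.adjoint L).continuous.comp_continuousOn h1).norm
  have hYm : MeasurableSet Y := by
    have : Y = closure V ∩ (fun y => ‖ContinuousLinearMap.adjoint L (modGrad c U V ybar q y)‖) ⁻¹'
        Iic R := rfl
    rw [this]
    exact (hcont.preimage_isClosed_of_isClosed isClosed_closure isClosed_Iic).measurableSet
  have hinj : InjOn (fun y => -modGrad c U V ybar q y) Y := by
    intro y₁ hy₁ y₂ hy₂ heq
    have hx := h.costExp_mem hyb hqD
    have e1 := congrArg (fun v => mixedHessian c U V (costExp c U V ybar q) ybar v)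
      (neg_injective heq)
    simp only [modGrad, h.mixedHessian_inverse_apply hx hyb, sub_left_inj] at e1
    exact h.injOn_gradFst hx hy₁.1 hy₂.1 (congrArg Neg.neg e1)
  refine (volume_le_mul_volume_image hYm (fun y hy =>
    (h.hasFDerivWithinAt_modGrad hyb hqD hy.1).mono hYV) hinj (fun y hy => ?_)).trans
      (mul_le_mul_right (measure_mono ?_) _)
  · have := h.one_le_gammaMinus_mul hyb hQ hq hy.1
    rwa [h.mixedHessian_modCost hyb hqD hy.1] at this
  · rintro _ ⟨y, hy, rfl⟩
    simpa using hy.2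

/-- Sections of a function which is convex with respect to the modified cost are convex, as
intersections of sublevel sets of quasiconvex functions. -/
theorem convex_section (hB3 : CondB3 c U V) (hyb : ybar ∈ closure V) {u : Eu n → ℝ}
    (hu : IsCostConvex (modCost c U V ybar) (closure (domFrom c U V ybar)) (closure V) u) :
    Convex ℝ {q | q ∈ closure (domFrom c U V ybar) ∧ u q ≤ 0} := by
  obtain ⟨v, -, hv⟩ := hu
  intro p hp q hq a b ha hb hab
  have hmem := (h.b2.1 ybar hyb).closure hp.1 hq.1 ha hb hab
  refine ⟨hmem, (isLUB_le_iff (hv _ hmem)).2 ?_⟩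
  rintro _ ⟨y, hy, rfl⟩
  have h1 : ∀ q ∈ closure (domFrom c U V ybar), u q ≤ 0 → -modCost c U V ybar q y ≤ v y := by
    intro q hq hq0
    have := (hv q hq).1 (mem_image_of_mem _ hy)
    simp only at this
    linarith
  have h2 := h.quasiconvexOn_neg_modCost hB3 hyb hy (v y) ⟨hp.1, h1 p hp.1 hp.2⟩
    ⟨hq.1, h1 q hq.1 hq.2⟩ ha hb hab
  simp only
  linarith [h2.2]

end RegularCost

end Estimate

/-! ### The Alexandrov estimate -/

section Alexandrov

variable {n : ℕ} {c : Eu n → Eu n → ℝ} {U V : Set (Eu n)} {ybar : Eu n}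

/-- The operator norm is at most half the diameter of the image of the unit ball. -/
theorem norm_le_of_forall_dist_le {L : Eu n →L[ℝ] Eu n} {a : Eu n} {B d : ℝ} (hB : 0 ≤ B)
    (hd : ∀ v w : Eu n, ‖v‖ ≤ 1 → ‖w‖ ≤ 1 → dist (a + L v) (a + L w) ≤ d) (hBd : d ≤ 2 * B) :
    ‖L‖ ≤ B := by
  refine ContinuousLinearMap.opNorm_le_of_unit_norm hB fun v hv => ?_
  have h1 := hd v (-v) hv.le (by rw [norm_neg]; exact hv.le)
  rw [dist_eq_norm, map_neg, add_sub_add_left_eq_sub, sub_neg_eq_add, ← two_smul ℝ, norm_smul,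
    Real.norm_two] at h1
  linarith

namespace RegularCost

variable (h : RegularCost c U V)
include h

/-- The bound on `δ` in terms of `ε_c`, in real numbers. -/
theorem mul_le_one_of_le_epsCost {δ d : ℝ} (hd : 0 ≤ d)
    (hδ : ENNReal.ofReal δ ≤ epsCost c U V / ENNReal.ofReal (4 * d)) (hδ0 : 0 ≤ δ) :
    δ * (4 * d) * (2 * (betaPlus c U V).toReal ^ 4 * (betaMinus c U V).toReal ^ 6 *
      (eLpNorm (fun z : Eu n × Eu n => mixedThird c U V z.1 z.2) ⊤
        (volume.restrict (U ×ˢ V))).toReal) ≤ 1 := by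
  have h1 : betaPlus c U V ≠ ⊤ := h.eLpNorm_ne_top h.contDiffOn_mixedHessian.continuousOn
  have h2 : betaMinus c U V ≠ ⊤ := h.eLpNorm_ne_top h.contDiffOn_inverse.continuousOn
  have h3 := h.eLpNorm_ne_top h.continuousOn_mixedThird
  have h4 := ENNReal.mul_le_of_le_div hδ
  rw [epsCost, ENNReal.le_inv_iff_mul_le] at h4
  have h5 := ENNReal.toReal_mono ENNReal.one_ne_top h4
  simpa only [ENNReal.toReal_mul, ENNReal.toReal_pow, ENNReal.toReal_ofReal hδ0,
    ENNReal.toReal_ofReal (by positivity : (0 : ℝ) ≤ 4 * d), ENNReal.toReal_ofNat,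
    ENNReal.toReal_one] using h5

/-- Every `y` in the subdifferential of a point of the concentric ellipsoid of half the size has
its gradient at the centre, `modGrad q₀ y`, in the body dual to the ellipsoid. -/
theorem norm_adjoint_modGrad_le (hB3 : CondB3 c U V) (hyb : ybar ∈ closure V) {u : Eu n → ℝ}
    {q₀ : Eu n} {L : Eu n →L[ℝ] Eu n} {δ H ρ : ℝ} (hδ : 0 < δ) (hH : 0 ≤ H)
    (hρ : δ * ‖L‖ ≤ ρ)
    (hball : Metric.closedBall q₀ (2 * ρ) ⊆ domFrom c U V ybar)
    (hρε : 2 * (betaPlus c U V).toReal ^ 4 * (betaMinus c U V).toReal ^ 6 *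
      (eLpNorm (fun z : Eu n × Eu n => mixedThird c U V z.1 z.2) ⊤
        (volume.restrict (U ×ˢ V))).toReal * (2 * ρ) ≤ 1 / 4)
    (hE : ∀ v, ‖v‖ ≤ 1 → q₀ + δ • L v ∈ closure (domFrom c U V ybar) ∧ u (q₀ + δ • L v) ≤ 0)
    {v₁ : Eu n} (hv₁ : ‖v₁‖ ≤ 1 / 2) (hu : -H ≤ u (q₀ + δ • L v₁)) {y : Eu n}
    (hy : y ∈ costSubdiff (modCost c U V ybar) (closure (domFrom c U V ybar)) (closure V) u
      (q₀ + δ • L v₁)) :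
    ‖ContinuousLinearMap.adjoint L (modGrad c U V ybar q₀ y)‖ ≤ 15 * H / δ := by
  obtain ⟨-, hyV, hlub⟩ := hy
  set q := q₀ + δ • L v₁ with hq
  set K := 2 * (betaPlus c U V).toReal ^ 4 * (betaMinus c U V).toReal ^ 6 *
      (eLpNorm (fun z : Eu n × Eu n => mixedThird c U V z.1 z.2) ⊤
        (volume.restrict (U ×ˢ V))).toReal with hK
  set k := modCost c U V ybar q y + u q with hk
  have hρ0 : 0 ≤ ρ := le_trans (by positivity) hρ
  have hle : ∀ p ∈ closure (domFrom c U V ybar), -modCost c U V ybar p y + k ≤ u p := by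
    intro p hp
    have := hlub.1 (mem_image_of_mem _ hp)
    linarith
  have hqc : QuasiconvexOn ℝ (closure (domFrom c U V ybar))
      (fun p => -modCost c U V ybar p y + k) := by
    intro r
    have h1 := h.quasiconvexOn_neg_modCost hB3 hyb hyV (r - k)
    simpa only [le_sub_iff_add_le] using h1
  have hq₀ : q₀ ∈ Metric.closedBall q₀ (2 * ρ) := Metric.mem_closedBall_self (by linarith)
  refine norm_adjoint_apply_le_of_inner_le (by positivity) fun v hv => ?_
  rw [le_div_iff₀ hδ, mul_comm, ← inner_smul_right, ← smul_apply]
  refine inner_le_of_quasiconvexOn (g := fun p => modGrad c U V ybar p y) (ρ := ρ) (v₁ := v₁)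
    (T := δ • L) hqc (hball.trans subset_closure) (fun p hp => ⟨?_, ?_⟩) (fun w hw => ?_)
    (fun w hw => ?_) hv₁ ?_ hv
  · have h1 := (h.hasGradientWithinAt_neg_modCost hyb (subset_closure (hball hp))
      hyV).hasFDerivWithinAt.hasFDerivAt (Filter.mem_of_superset
        ((h.isOpen_domFrom hyb).mem_nhds (hball hp)) subset_closure)
    exact h1.add_const k
  · refine (h.norm_modGrad_sub_le hyb
      (fun z hz => h.norm_le_toReal_eLpNorm h.contDiffOn_mixedHessian.continuousOn hz)
      (fun z hz => h.norm_le_toReal_eLpNorm h.contDiffOn_inverse.continuousOn hz)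
      (fun z hz => h.norm_le_toReal_eLpNorm h.continuousOn_mixedThird hz)
      (subset_closure (hball hq₀)) (subset_closure (hball hp)) hyV).trans ?_
    refine mul_le_mul_of_nonneg_right (le_trans ?_ hρε) (norm_nonneg _)
    have h2 : ‖p - q₀‖ ≤ 2 * ρ := by simpa [dist_eq_norm] using hp
    exact mul_le_mul_of_nonneg_left h2 (by positivity)
  · rw [smul_apply, norm_smul, Real.norm_of_nonneg hδ.le]
    refine le_trans (mul_le_mul_of_nonneg_left ?_ hδ.le) hρ
    exact (L.le_opNorm w).trans (mul_le_of_le_one_right (norm_nonneg _) hw)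
  · have h1 := hE w hw
    exact (hle _ h1.1).trans h1.2
  · rw [smul_apply, ← hq, hk]
    simpa using hu

/-- The estimate of `vol(Q)²`, for a section `Q` comparable to an ellipsoid. -/
theorem volume_sq_le (hB3 : CondB3 c U V) (hyb : ybar ∈ closure V) {u : Eu n → ℝ}
    (hu : IsCostConvex (modCost c U V ybar) (closure (domFrom c U V ybar)) (closure V) u)
    {Q : Set (Eu n)} (hQ : Q = {q | q ∈ closure (domFrom c U V ybar) ∧ u q ≤ 0}) {a : Eu n}
    {L : Eu n ≃L[ℝ] Eu n} (hQE : Q ⊆ ellipsoid a L n) {x₀ : Eu n} {δ : ℝ} {Ed : Set (Eu n)}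
    (hδ : 0 < δ)
    (hδε : ENNReal.ofReal δ ≤ epsCost c U V / ENNReal.ofReal (4 * Metric.diam (ellipsoid a L 1)))
    (hEd : Ed = (fun q => x₀ + q) '' ellipsoid a L δ) (hEdQ : Ed ⊆ Q) {lam : ℝ} (hlam : 0 < lam)
    (hMA : MongeAmpereGE (modCost c U V ybar) (closure (domFrom c U V ybar)) (closure V) u lam Ed)
    {z : Eu n} {r : ℝ} (hr : 0 < r) (hEr : Ed ⊆ Metric.closedBall z r)
    (hzr : Metric.ball z (4 * r) ⊆ domFrom c U V ybar) :
    volume Q ^ 2 ≤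
      ENNReal.ofReal (((n : ℝ) ^ n) ^ 2 *
        (volume (Metric.closedBall (0 : Eu n) 1)).toReal ^ 2 * 30 ^ n) *
        (gammaMinus (modCost c U V ybar) (domFrom c U V ybar) V Q /
          ENNReal.ofReal (δ ^ (2 * n) * lam)) * ENNReal.ofReal (|sInf (u '' Q)| ^ n) := by
  set T : Eu n →L[ℝ] Eu n := (L : Eu n →L[ℝ] Eu n) with hT
  set q₀ := x₀ + a with hq₀
  have hEdmem : ∀ v, ‖v‖ ≤ 1 → q₀ + δ • T v ∈ Ed := by
    intro v hv
    rw [hEd]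
    refine ⟨a + δ • L v, ⟨v, by simpa using hv, rfl⟩, ?_⟩
    simp only [hq₀, hT, ContinuousLinearEquiv.coe_coe]
    abel
  have hQD : Q ⊆ closure (domFrom c U V ybar) := by rw [hQ]; exact fun q hq => hq.1
  -- the infimum of `u` over `Q` is not a junk value
  have hbdd : BddBelow (u '' Q) := by
    obtain ⟨v, -, hv⟩ := hu
    refine ⟨-v ybar, ?_⟩
    rintro _ ⟨q, hq, rfl⟩
    have := (hv q (hQD hq)).1 (mem_image_of_mem _ hyb)
    simpa [modCost] using this
  set H := |sInf (u '' Q)| with hH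
  have hHle : ∀ q ∈ Q, -H ≤ u q := fun q hq =>
    (neg_abs_le _).trans (csInf_le hbdd (mem_image_of_mem u hq))
  -- Euclidean size of the small ellipsoid
  have hdiam : 0 ≤ Metric.diam (ellipsoid a L 1) := Metric.diam_nonneg
  have hnorm : ‖T‖ ≤ Metric.diam (ellipsoid a L 1) / 2 := by
    refine norm_le_of_forall_dist_le (a := a) (by positivity) (fun v w hv hw => ?_)
      (by linarith : Metric.diam (ellipsoid a L 1) ≤ _)
    exact Metric.dist_le_diam_of_mem (isCompact_ellipsoid a L 1).isBounded
      ⟨v, by simpa using hv, by simp [hT]⟩ ⟨w, by simpa using hw, by simp [hT]⟩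
  have hnormr : δ * ‖T‖ ≤ r := by
    have h1 : ‖δ • T‖ ≤ r := by
      refine norm_le_of_forall_dist_le (a := q₀) hr.le (fun v w hv hw => ?_) le_rfl
      have e1 := hEr (hEdmem v hv)
      have e2 := hEr (hEdmem w hw)
      rw [Metric.mem_closedBall] at e1 e2
      have := dist_triangle_right (q₀ + δ • T v) (q₀ + δ • T w) z
      simp only [smul_apply]
      linarith
    rwa [norm_smul, Real.norm_of_nonneg hδ.le] at h1
  have hq₀z : q₀ ∈ Metric.closedBall z r := by simpa using hEr (hEdmem 0 (by simp))
  have hball : Metric.closedBall q₀ (2 * (δ * ‖T‖)) ⊆ domFrom c U V ybar := by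
    refine Subset.trans (fun p hp => ?_) hzr
    rw [Metric.mem_closedBall] at hp hq₀z
    rw [Metric.mem_ball]
    linarith [dist_triangle p q₀ z]
  have hρε := h.mul_le_one_of_le_epsCost hdiam hδε hδ.le
  have hint : q₀ ∈ interior Q := by
    have hopen : IsOpen ((fun v => q₀ + δ • L v) '' Metric.ball 0 1) := by
      have h1 : (fun v => q₀ + δ • L v) =
          (Homeomorph.addLeft q₀) ∘ (Homeomorph.smulOfNeZero δ hδ.ne') ∘ L := by funext v; rfl
      rw [h1]
      exact ((Homeomorph.addLeft q₀).isOpenMap.comp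
        ((Homeomorph.smulOfNeZero δ hδ.ne').isOpenMap.comp L.toHomeomorph.isOpenMap)) _
          Metric.isOpen_ball
    refine interior_maximal ?_ hopen ⟨0, by simp, by simp⟩
    rintro _ ⟨v, hv, rfl⟩
    exact hEdQ (hEdmem v (by simpa using (mem_ball_zero_iff.1 hv).le))
  have hsub : ∀ v, ‖v‖ ≤ 1 / 2 → costSubdiff (modCost c U V ybar) (closure (domFrom c U V ybar))
      (closure V) u (q₀ + δ • T v) ⊆ {y | y ∈ closure V ∧
        ‖ContinuousLinearMap.adjoint T (modGrad c U V ybar q₀ y)‖ ≤ 15 * H / δ} := by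
    intro v hv y hy
    refine ⟨hy.2.1, h.norm_adjoint_modGrad_le hB3 hyb hδ (abs_nonneg _) le_rfl hball ?_ ?_ hv
      (hHle _ (hEdQ (hEdmem v (by linarith)))) hy⟩
    · have h1 := mul_le_mul_of_nonneg_left hnorm hδ.le
      set K := 2 * (betaPlus c U V).toReal ^ 4 * (betaMinus c U V).toReal ^ 6 *
        (eLpNorm (fun z : Eu n × Eu n => mixedThird c U V z.1 z.2) ⊤
          (volume.restrict (U ×ˢ V))).toReal
      have hK0 : 0 ≤ K := by positivity
      have h2 := mul_le_mul_of_nonneg_left h1 hK0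
      linarith
    · intro w hw
      have := hEdQ (hEdmem w hw)
      rw [hQ] at this
      exact this
  -- the Monge-Ampère measure of the concentric ellipsoid of half the size
  have hhalf : ellipsoid q₀ L (δ / 2) ⊆ Ed := by
    rintro _ ⟨v, hv, rfl⟩
    have h1 := hEdmem ((1 / 2 : ℝ) • v) (by
      rw [norm_smul]; norm_num; linarith [mem_closedBall_zero_iff.1 hv])
    rwa [map_smul, smul_smul, mul_one_div] at h1
  have hMA' := (hMA _ (isCompact_ellipsoid q₀ L (δ / 2)).measurableSet hhalf).trans
    ((measure_mono (iUnion₂_subset fun q hq => ?_)).trans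
      (h.volume_le_gammaMinus_mul hyb hQD hint (L := T) (R := 15 * H / δ)))
  · rw [volume_ellipsoid q₀ L (by positivity)] at hMA'
    refine sq_le_of_volume_ineq (D := |LinearMap.det (T : Eu n →ₗ[ℝ] Eu n)|) (abs_pos.2 ?_) hδ hlam
      (abs_nonneg _) (Metric.measure_closedBall_pos volume _ one_pos).ne'
      measure_closedBall_lt_top.ne ?_ (volume_adjoint_le L (by positivity)) hMA'
    · exact (LinearEquiv.isUnit_det' L.toLinearEquiv).ne_zero
    · rw [← volume_ellipsoid a L (Nat.cast_nonneg n)]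
      exact measure_mono hQE
  · obtain ⟨v, hv, rfl⟩ := hq
    have h1 := hsub ((1 / 2 : ℝ) • v) (by
      rw [norm_smul]; norm_num; linarith [mem_closedBall_zero_iff.1 hv])
    rwa [map_smul, smul_smul, mul_one_div] at h1

end RegularCost

end Alexandrov

end OptTransport

end

theorem mainTheorem7 (n : ℕ) :
    ∃ C : ℝ, 0 < C ∧
      ∀ (c : OptTransport.Eu n → OptTransport.Eu n → ℝ) (U V : Set (OptTransport.Eu n)),
        OptTransport.CondB0 c U V → OptTransport.CondB1 c U V →
        OptTransport.CondB2 c U V → OptTransport.CondB3 c U V →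
      ∀ ybar ∈ closure V,
      ∀ (Uy : Set (OptTransport.Eu n)), Uy = OptTransport.domFrom c U V ybar →
      ∀ (ct : OptTransport.Eu n → OptTransport.Eu n → ℝ),
        ct = OptTransport.modCost c U V ybar →
      ∀ (ut : OptTransport.Eu n → ℝ),
        OptTransport.IsCostConvex ct (closure Uy) (closure V) ut →
      ∀ (Q : Set (OptTransport.Eu n)), Q = {q | q ∈ closure Uy ∧ ut q ≤ 0} →
        -- the section is convex
        Convex ℝ Q ∧
        -- `E = ellipsoid a L 1` is an ellipsoid with `E ⊆ Q ⊆ n • E`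
        ∀ (a : OptTransport.Eu n) (L : OptTransport.Eu n ≃L[ℝ] OptTransport.Eu n),
          OptTransport.ellipsoid a L 1 ⊆ Q →
          Q ⊆ OptTransport.ellipsoid a L n →
        -- `Ed = x₀ + δ • E`
        ∀ (x₀ : OptTransport.Eu n) (δ : ℝ) (Ed : Set (OptTransport.Eu n)),
          0 < δ →
          ENNReal.ofReal δ ≤ min 1 (OptTransport.epsCost c U V /
            ENNReal.ofReal (4 * Metric.diam (OptTransport.ellipsoid a L 1))) →
          Ed = (fun q => x₀ + q) '' OptTransport.ellipsoid a L δ →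
          Ed ⊆ Q →
        ∀ lam : ℝ, 0 < lam →
          OptTransport.MongeAmpereGE ct (closure Uy) (closure V) ut lam Ed →
        ∀ (z : OptTransport.Eu n) (r : ℝ), 0 < r →
          Ed ⊆ Metric.closedBall z r → Metric.ball z (4 * r) ⊆ Uy →
          MeasureTheory.volume Q ^ 2 ≤
            ENNReal.ofReal C *
              (OptTransport.gammaMinus ct Uy V Q / ENNReal.ofReal (δ ^ (2 * n) * lam)) *
              ENNReal.ofReal (|sInf (ut '' Q)| ^ n) := by
  refine ⟨((n : ℝ) ^ n) ^ 2 *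
    (MeasureTheory.volume (Metric.closedBall (0 : OptTransport.Eu n) 1)).toReal ^ 2 * 30 ^ n,
    ?_, ?_⟩
  · have h1 : 0 < (MeasureTheory.volume (Metric.closedBall (0 : OptTransport.Eu n) 1)).toReal :=
      ENNReal.toReal_pos (Metric.measure_closedBall_pos MeasureTheory.volume _ one_pos).ne'
        MeasureTheory.measure_closedBall_lt_top.ne
    have h2 : 0 < (n : ℝ) ^ n := by
      rcases Nat.eq_zero_or_pos n with rfl | hn
      · simp
      · positivity
    positivity
  · intro c U V h0 h1 h2 h3 ybar hyb Uy hUy ct hct ut hut Q hQ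
    subst hUy hct
    -- if `U` is empty then so is `Q`, and there is no ellipsoid `E`
    rcases U.eq_empty_or_nonempty with hU | hU
    · have hQe : Q = ∅ := by rw [hQ, hU]; simp [OptTransport.domFrom]
      rw [hQe]
      refine ⟨convex_empty, fun a L hE => ?_⟩
      exact absurd (hE ⟨0, by simp, rfl⟩) (Set.notMem_empty _)
    have h : OptTransport.RegularCost c U V :=
      ⟨h0, h1, h2, hU, closure_nonempty_iff.1 ⟨ybar, hyb⟩⟩
    refine ⟨hQ ▸ h.convex_section h3 hyb hut, ?_⟩
    intro a L _ hQE x₀ δ Ed hδ hδε hEd hEdQ lam hlam hMA z r hr hEr hzr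
    exact h.volume_sq_le h3 hyb hut hQ hQE hδ (hδε.trans (min_le_right _ _)) hEd hEdQ hlam hMA hr
      hEr hzr
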